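/- Fix a field $\Bbbk$ and integers $n,m>1$, and set $N:=n+m-1$. A persistence module over a poset $P$ is a functor from $P$ to finite-dimensional $\Bbbk$-vector spaces. An interval of $P$ is a non-empty, connected, convex subset $I\subseteq P$; its interval module $\Bbbk I$ is $\Bbbk$ at the points of $I$ and $0$ elsewhere, with internal maps the identity between points of $I$ and $0$ otherwise. The barcode of a persistence module $F$ is the multiset $(S,\mu)$ of intervals, where $\mu(I)$ is the multiplicity of $I$ and $S=\{I:\mu(I)\neq 0\}$, such that $F\cong\bigoplus_{I\in S}(\Bbbk I)^{\mu(I)}$. Let $B=\{0,\dots,n+m-1\}$ be the bipath poset, whose order is given by the two maximal chains $0<1<\dots<n$ and $0<n+m-1<n+m-2<\dots<n$. Let $\mathbb{ZZ}=\{(a,b)\in\mathbb Z^{\mathrm{op}}\times\mathbb Z : a=b\text{ or }a=b+1\}$ be the zigzag poset. Let $\zeta\colon\mathbb{ZZ}\to B$ be the covering map, given for all $k\in\mathbb Z$ by $$\zeta(kN+1,kN)=0,\qquad \zeta(kN+n,kN+n)=n,$$ $$\zeta(kN+i,kN+i)=\zeta(kN+i+1,kN+i)=i\quad(1\le i\le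 n-1),$$ $$\zeta(kN-i+1,kN-i)=\zeta(kN-i+1,kN-i+1)=n+m-i\quad(1\le i\le m-1).$$ For a persistence module $M$ over $B$ (a bipath module), let $R(M):=M\circ\zeta$. The barcode of $M$ is called its arc code. **Theorem.** Let $M$ be a bipath module. The arc code $(S,\mu)$ of $M$ and the barcode $(S',\mu')$ of $R(M)$ exist and are unique, and: 1. The barcode of $R(M)$ is a complete invariant of $M$: for every bipath module $M'$, the barcodes of $R(M)$ and $R(M')$ are equal if and only if $M\cong M'$. 2. The group $\mathbb Z$ acts on $S'$, where $z\in\mathbb Z$ sends $J$ to its translate $z\uparrow J:=\{(a+zN,b+zN):(a,b)\in J\}$ (that is, $zN$ is added to each endpoint of $J$), and $\mu'(z\uparrow J)=\mu'(J)$ for all $z\in\mathbb Z$ and $J\in S'$. 3. There is a bijection $\phi\colon S\to S'/\mathbb Z$ onto the orbit space such that $\mu'(J)=\mu(I)$ for all $I\in S$ and all $J\in\phi(I)$. -/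

import Mathlib

open CategoryTheory

universe u

namespace BipathPersistence

noncomputable section

/-! ### Persistence modules, intervals and barcodes over a poset -/

/-- Persistence modules over `P`: functors from `P` to finite-dimensional `k`-vector spaces.
Their morphisms are the natural transformations. -/
abbrev PersistenceModule (k : Type u) [Field k] (P : Type) [PartialOrder P] :=
  P ⥤ FGModuleCat.{u} k

/-- An interval of `P`: a nonempty, convex and connected subset. -/
@[ext]
structure PosetInterval (P : Type) [PartialOrder P] where
  carrier : Set P
  nonempty : carrier.Nonempty
  convex : ∀ ⦃p z q : P⦄, p ∈ carrier → q ∈ carrier → p ≤ z → z ≤ q → z ∈ carrier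
  connected : ∀ ⦃p q : P⦄, p ∈ carrier → q ∈ carrier →
    Relation.ReflTransGen (fun x y => x ∈ carrier ∧ y ∈ carrier ∧ (x ≤ y ∨ y ≤ x)) p q

open Classical in
/-- The internal map `p → q` of the interval module on `I`. The space at `p` is the space of
functions `PLift (p ∈ I) → k`: this is `k` if `p ∈ I`, and `0` otherwise. The map is the
identity of `k` if `p, q ∈ I`, and `0` otherwise. -/
def intervalMap (k : Type u) [Field k] {P : Type} [PartialOrder P] (I : PosetInterval P) (p q : P) :
    (PLift (p ∈ I.carrier) → k) →ₗ[k] (PLift (q ∈ I.carrier) → k) where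
  toFun f := fun _ => if hp : p ∈ I.carrier then f ⟨hp⟩ else 0
  map_add' f g := by
    funext _
    by_cases hp : p ∈ I.carrier <;> simp [hp]
  map_smul' c f := by
    funext _
    by_cases hp : p ∈ I.carrier <;> simp [hp]

/-- The interval module supported on `I`. -/
def intervalModule (k : Type u) [Field k] {P : Type} [PartialOrder P] (I : PosetInterval P) :
    PersistenceModule k P where
  obj p := FGModuleCat.of k (PLift (p ∈ I.carrier) → k)
  map {p q} _ := FGModuleCat.ofHom (intervalMap k I p q)
  map_id p := by
    apply FGModuleCat.hom_ext
    apply LinearMap.ext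
    intro f
    funext h
    exact dif_pos h.down
  map_comp {p q r} f g := by
    classical
    apply FGModuleCat.hom_ext
    apply LinearMap.ext
    intro v
    funext h
    change (if hp : p ∈ I.carrier then v ⟨hp⟩ else 0) =
      (if _ : q ∈ I.carrier then (if hp : p ∈ I.carrier then v ⟨hp⟩ else 0) else 0)
    by_cases hp : p ∈ I.carrier
    · rw [dif_pos (I.convex hp h.down (leOfHom f) (leOfHom g))]
    · simp [hp]

/-- The pointwise direct sum of a family of persistence modules. Over an infinite family it need
not be pointwise finite-dimensional, so it takes values in all vector spaces. -/
def directSum {k : Type u} [Field k] {P : Type} [PartialOrder P] {J : Type}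
    (F : J → PersistenceModule k P) : P ⥤ ModuleCat.{u} k where
  obj p := ModuleCat.of k (DirectSum J fun j => ((F j).obj p : Type u))
  map {_ _} f := ModuleCat.ofHom (DirectSum.lmap fun j => ((F j).map f).hom.hom)
  map_id p := by
    apply ModuleCat.hom_ext
    apply LinearMap.ext
    intro x
    refine DFinsupp.ext fun j => ?_
    simp
  map_comp f g := by
    apply ModuleCat.hom_ext
    apply LinearMap.ext
    intro x
    refine DFinsupp.ext fun j => ?_
    simp [DirectSum.lmap_apply]

/-- The set underlying the multiset of intervals with multiplicity function `μ`. -/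
abbrev supp {P : Type} [PartialOrder P] (μ : PosetInterval P → ℕ) : Type :=
  {I : PosetInterval P // μ I ≠ 0}

/-- `M` is isomorphic to the direct sum of the interval modules `k I`, each repeated `μ I`
times. -/
def HasBarcode {k : Type u} [Field k] {P : Type} [PartialOrder P]
    (M : PersistenceModule k P) (μ : PosetInterval P → ℕ) : Prop :=
  Nonempty ((M ⋙ forget₂ (FGModuleCat.{u} k) (ModuleCat.{u} k)) ≅
    directSum fun j : (Σ I : PosetInterval P, Fin (μ I)) => intervalModule k j.1)

open Classical in
/-- The barcode of `M`, as a multiplicity function on intervals (the arc code, if the poset is a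
bipath poset). The value `0` for modules without a barcode is a convention. -/
def barcode {k : Type u} [Field k] {P : Type} [PartialOrder P]
    (M : PersistenceModule k P) : PosetInterval P → ℕ :=
  if h : ∃ μ, HasBarcode M μ then h.choose else 0

/-! ### The bipath poset -/

/-- The underlying set `{0, …, n + m - 1}` of the bipath poset. -/
@[ext]
structure Bipath (n m : ℕ) where
  val : ℕ
  lt : val < n + m

/-- The order given by the two maximal chains `0 < 1 < ⋯ < n` and
`0 < n + m - 1 < n + m - 2 < ⋯ < n`. (The condition `0 < n` only serves to have an order for
`n = 0` as well.) -/
instance (n m : ℕ) : PartialOrder (Bipath n m) where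
  le x y := (x.val ≤ y.val ∧ y.val ≤ n) ∨ (n ≤ y.val ∧ y.val ≤ x.val) ∨ (x.val = 0 ∧ 0 < n)
  le_refl x := by omega
  le_trans x y z h h' := by omega
  le_antisymm x y h h' := by
    ext
    omega

/-! ### The zigzag poset -/

/-- The subposet `{(a, b) | a = b or a = b + 1}` of `ℤᵒᵖ × ℤ`. -/
abbrev ZZ : Type :=
  {p : ℤᵒᵈ × ℤ // OrderDual.ofDual p.1 = p.2 ∨ OrderDual.ofDual p.1 = p.2 + 1}

namespace ZZ

/-- The first coordinate, as an integer. -/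
def fst (p : ZZ) : ℤ := OrderDual.ofDual p.1.1

/-- The second coordinate. -/
def snd (p : ZZ) : ℤ := p.1.2

/-- The element `(a, b)`. -/
def mk (a b : ℤ) (h : a = b ∨ a = b + 1) : ZZ := ⟨(OrderDual.toDual a, b), h⟩

theorem fst_or (p : ZZ) : p.fst = p.snd ∨ p.fst = p.snd + 1 := p.2

theorem le_iff (p q : ZZ) : p ≤ q ↔ q.fst ≤ p.fst ∧ p.snd ≤ q.snd := Iff.rfl

/-- Translation by `(t, t)`. -/
def translate (t : ℤ) (p : ZZ) : ZZ :=
  mk (p.fst + t) (p.snd + t) (by have := p.fst_or; omega)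

theorem translate_neg_translate (t : ℤ) (p : ZZ) : translate (-t) (translate t p) = p := by
  apply Subtype.ext
  apply Prod.ext
  · exact add_neg_cancel_right p.fst t
  · exact add_neg_cancel_right p.snd t

theorem translate_translate_neg (t : ℤ) (p : ZZ) : translate t (translate (-t) p) = p := by
  apply Subtype.ext
  apply Prod.ext
  · exact neg_add_cancel_right p.fst t
  · exact neg_add_cancel_right p.snd t

theorem translate_mono (t : ℤ) {p q : ZZ} (h : p ≤ q) : translate t p ≤ translate t q := by
  rw [le_iff] at h ⊢
  exact ⟨add_le_add_left h.1 t, add_le_add_left h.2 t⟩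

end ZZ

/-- The translate of the interval `J` by `t`. By `mem_shift_cc`, `mem_shift_co`, `mem_shift_oc`
and `mem_shift_oo` below, this adds `t` to the endpoints of `J`. -/
def shift (t : ℤ) (J : PosetInterval ZZ) : PosetInterval ZZ where
  carrier := {p | ZZ.translate (-t) p ∈ J.carrier}
  nonempty := by
    obtain ⟨p, hp⟩ := J.nonempty
    exact ⟨ZZ.translate t p, by simpa only [Set.mem_ofPred_eq, ZZ.translate_neg_translate]⟩
  convex := fun _ _ _ hp hq h h' =>
    J.convex hp hq (ZZ.translate_mono _ h) (ZZ.translate_mono _ h')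
  connected := by
    intro p q hp hq
    have key := Relation.ReflTransGen.lift (r := fun x y => x ∈ J.carrier ∧ y ∈ J.carrier ∧
        (x ≤ y ∨ y ≤ x)) (p := fun x y => ZZ.translate (-t) x ∈ J.carrier ∧
        ZZ.translate (-t) y ∈ J.carrier ∧ (x ≤ y ∨ y ≤ x)) (ZZ.translate t)
      (by
        rintro x y ⟨hx, hy, h⟩
        refine ⟨by rwa [ZZ.translate_neg_translate], by rwa [ZZ.translate_neg_translate], ?_⟩
        exact h.imp (ZZ.translate_mono t) (ZZ.translate_mono t))
      _ _ (J.connected hp hq)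
    simp only [Function.onFun, ZZ.translate_translate_neg] at key
    exact key

/-! ### Intervals of the zigzag poset by endpoints in `ℤ ∪ {±∞}` -/

/-- `[a, b]_ZZ` -/
def cc (a b : WithBot (WithTop ℤ)) : Set ZZ :=
  {p | ((p.fst : WithTop ℤ) : WithBot (WithTop ℤ)) ≤ b ∧
    a ≤ ((p.snd : WithTop ℤ) : WithBot (WithTop ℤ))}

/-- `[a, b)_ZZ` -/
def co (a b : WithBot (WithTop ℤ)) : Set ZZ :=
  {p | a ≤ ((p.snd : WithTop ℤ) : WithBot (WithTop ℤ)) ∧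
    ((p.snd : WithTop ℤ) : WithBot (WithTop ℤ)) < b}

/-- `(a, b]_ZZ` -/
def oc (a b : WithBot (WithTop ℤ)) : Set ZZ :=
  {p | a < ((p.fst : WithTop ℤ) : WithBot (WithTop ℤ)) ∧
    ((p.fst : WithTop ℤ) : WithBot (WithTop ℤ)) ≤ b}

/-- `(a, b)_ZZ` -/
def oo (a b : WithBot (WithTop ℤ)) : Set ZZ :=
  {p | a < ((p.fst : WithTop ℤ) : WithBot (WithTop ℤ)) ∧
    ((p.snd : WithTop ℤ) : WithBot (WithTop ℤ)) < b}

/-- Adding an integer to an endpoint fixes `±∞`. -/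
def addEnd (a : WithBot (WithTop ℤ)) (t : ℤ) : WithBot (WithTop ℤ) :=
  a + ((t : WithTop ℤ) : WithBot (WithTop ℤ))

theorem le_addEnd (c t : ℤ) (b : WithBot (WithTop ℤ)) :
    ((c + -t : ℤ) : WithTop ℤ) ≤ b ↔ ((c : ℤ) : WithTop ℤ) ≤ addEnd b t := by
  unfold addEnd
  induction b with
  | bot => simp
  | coe b =>
    induction b with
    | top =>
      have e : ((⊤ : WithTop ℤ) : WithBot (WithTop ℤ)) + ((t : WithTop ℤ) : WithBot (WithTop ℤ)) =
        ((⊤ : WithTop ℤ) : WithBot (WithTop ℤ)) := rfl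
      rw [e]
      simp
    | coe b =>
      norm_cast
      constructor <;> intro h <;> linarith

theorem addEnd_le (c t : ℤ) (b : WithBot (WithTop ℤ)) :
    b ≤ ((c + -t : ℤ) : WithTop ℤ) ↔ addEnd b t ≤ ((c : ℤ) : WithTop ℤ) := by
  unfold addEnd
  induction b with
  | bot => simp
  | coe b =>
    induction b with
    | top =>
      have e : ((⊤ : WithTop ℤ) : WithBot (WithTop ℤ)) + ((t : WithTop ℤ) : WithBot (WithTop ℤ)) =
        ((⊤ : WithTop ℤ) : WithBot (WithTop ℤ)) := rfl
      rw [e, WithBot.coe_le_coe, WithBot.coe_le_coe, top_le_iff, top_le_iff]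
      exact iff_of_false (WithTop.coe_ne_top) (WithTop.coe_ne_top)
    | coe b =>
      norm_cast
      constructor <;> intro h <;> linarith

theorem lt_addEnd (c t : ℤ) (b : WithBot (WithTop ℤ)) :
    ((c + -t : ℤ) : WithTop ℤ) < b ↔ ((c : ℤ) : WithTop ℤ) < addEnd b t := by
  rw [← not_le, ← not_le, addEnd_le]

theorem addEnd_lt (c t : ℤ) (b : WithBot (WithTop ℤ)) :
    b < ((c + -t : ℤ) : WithTop ℤ) ↔ addEnd b t < ((c : ℤ) : WithTop ℤ) := by
  rw [← not_le, ← not_le, le_addEnd]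

theorem mem_shift_cc (t : ℤ) (J : PosetInterval ZZ) (a b : WithBot (WithTop ℤ))
    (h : J.carrier = cc a b) : (shift t J).carrier = cc (addEnd a t) (addEnd b t) := by
  ext p
  change ZZ.translate (-t) p ∈ J.carrier ↔ _
  rw [h]
  exact and_congr (le_addEnd _ _ _) (addEnd_le _ _ _)

theorem mem_shift_co (t : ℤ) (J : PosetInterval ZZ) (a b : WithBot (WithTop ℤ))
    (h : J.carrier = co a b) : (shift t J).carrier = co (addEnd a t) (addEnd b t) := by
  ext p
  change ZZ.translate (-t) p ∈ J.carrier ↔ _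
  rw [h]
  exact and_congr (addEnd_le _ _ _) (lt_addEnd _ _ _)

theorem mem_shift_oc (t : ℤ) (J : PosetInterval ZZ) (a b : WithBot (WithTop ℤ))
    (h : J.carrier = oc a b) : (shift t J).carrier = oc (addEnd a t) (addEnd b t) := by
  ext p
  change ZZ.translate (-t) p ∈ J.carrier ↔ _
  rw [h]
  exact and_congr (addEnd_lt _ _ _) (le_addEnd _ _ _)

theorem mem_shift_oo (t : ℤ) (J : PosetInterval ZZ) (a b : WithBot (WithTop ℤ))
    (h : J.carrier = oo a b) : (shift t J).carrier = oo (addEnd a t) (addEnd b t) := by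
  ext p
  change ZZ.translate (-t) p ∈ J.carrier ↔ _
  rw [h]
  exact and_congr (addEnd_lt _ _ _) (lt_addEnd _ _ _)

/-! ### The covering map and the restriction functor -/

/-- The period `N = n + m - 1`. -/
def period (n m : ℕ) : ℤ := (n : ℤ) + m - 1

theorem emod_period_bounds {n m : ℕ} (hn : 1 < n) (b : ℤ) :
    0 ≤ b % period n m ∧ b % period n m < period n m :=
  ⟨Int.emod_nonneg _ (by unfold period; omega), Int.emod_lt_of_pos _ (by unfold period; omega)⟩

/-- The covering map on elements, through residues modulo `N`. A maximal element `(b, b)` goes to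
the residue of `b`, except that the residue `0` goes to `N`. A minimal element `(b + 1, b)` with
residue `r` of `b` goes to `r` if `r < n`, and to `r + 1` otherwise. The four lemmas
`coveringFun_zero`, …, `coveringFun_bottom` below give its values case by case. -/
def coveringFun {n m : ℕ} (hn : 1 < n) (p : ZZ) : Bipath n m where
  val :=
    if p.fst = p.snd then
      (if p.snd % period n m = 0 then n + m - 1 else (p.snd % period n m).toNat)
    else
      (if p.snd % period n m < n then (p.snd % period n m).toNat
        else (p.snd % period n m).toNat + 1)
  lt := by
    have h := emod_period_bounds (m := m) hn p.snd
    have hN : period n m = (n : ℤ) + m - 1 := rfl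
    split_ifs <;> omega

/-- `ζ(kN + 1, kN) = 0` -/
theorem coveringFun_zero {n m : ℕ} (hn : 1 < n) (k : ℤ) :
    (coveringFun hn (ZZ.mk (k * period n m + 1) (k * period n m) (Or.inr rfl)) :
      Bipath n m).val = 0 := by
  simp [coveringFun, ZZ.mk, ZZ.fst, ZZ.snd]
  omega

/-- `ζ(kN + i, kN + i) = ζ(kN + i + 1, kN + i) = i` for `1 ≤ i ≤ n - 1` -/
theorem coveringFun_top {n m : ℕ} (hn : 1 < n) (hm : 1 < m) (k : ℤ) (i : ℕ) (hi : 1 ≤ i)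
    (hi' : i ≤ n - 1) :
    (coveringFun hn (ZZ.mk (k * period n m + i) (k * period n m + i) (Or.inl rfl)) :
      Bipath n m).val = i ∧
    (coveringFun hn (ZZ.mk (k * period n m + i + 1) (k * period n m + i) (Or.inr rfl)) :
      Bipath n m).val = i := by
  have h : (k * period n m + i) % period n m = i := by
    rw [add_comm, Int.add_mul_emod_self_right]
    exact Int.emod_eq_of_lt (by omega) (by unfold period; omega)
  simp only [coveringFun, ZZ.mk, ZZ.fst, ZZ.snd, OrderDual.ofDual_toDual, h]
  constructor <;> split_ifs <;> omega

/-- `ζ(kN + n, kN + n) = n` -/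
theorem coveringFun_n {n m : ℕ} (hn : 1 < n) (hm : 1 < m) (k : ℤ) :
    (coveringFun hn (ZZ.mk (k * period n m + n) (k * period n m + n) (Or.inl rfl)) :
      Bipath n m).val = n := by
  have h : (k * period n m + n) % period n m = n := by
    rw [add_comm, Int.add_mul_emod_self_right]
    exact Int.emod_eq_of_lt (by omega) (by unfold period; omega)
  simp only [coveringFun, ZZ.mk, ZZ.fst, ZZ.snd, OrderDual.ofDual_toDual, h]
  split_ifs <;> omega

/-- `ζ(kN - i + 1, kN - i) = ζ(kN - i + 1, kN - i + 1) = n + m - i` for `1 ≤ i ≤ m - 1` -/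
theorem coveringFun_bottom {n m : ℕ} (hn : 1 < n) (hm : 1 < m) (k : ℤ) (i : ℕ) (hi : 1 ≤ i)
    (hi' : i ≤ m - 1) :
    (coveringFun hn (ZZ.mk (k * period n m - i + 1) (k * period n m - i) (Or.inr rfl)) :
      Bipath n m).val = n + m - i ∧
    (coveringFun hn (ZZ.mk (k * period n m - i + 1) (k * period n m - i + 1) (Or.inl rfl)) :
      Bipath n m).val = n + m - i := by
  have hN : period n m = (n : ℤ) + m - 1 := rfl
  have h : (k * period n m - i) % period n m = period n m - i := by
    rw [show k * period n m - i = (period n m - i) + (k - 1) * period n m by ring,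
      Int.add_mul_emod_self_right]
    exact Int.emod_eq_of_lt (by omega) (by omega)
  have h' : (k * period n m - i + 1) % period n m = if i = 1 then 0 else period n m - i + 1 := by
    split_ifs with h1
    · simp [h1]
    · rw [show k * period n m - i + 1 = (period n m - i + 1) + (k - 1) * period n m by ring,
        Int.add_mul_emod_self_right]
      exact Int.emod_eq_of_lt (by omega) (by omega)
  simp only [coveringFun, ZZ.mk, ZZ.fst, ZZ.snd, OrderDual.ofDual_toDual, h, h']
  constructor <;> split_ifs <;> omega

/-- The covering map `ζ : ZZ → B`. -/
def covering {n m : ℕ} (hn : 1 < n) (hm : 1 < m) : ZZ →o Bipath n m where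
  toFun := coveringFun hn
  monotone' := by
    intro p q h
    have hN : period n m = (n : ℤ) + m - 1 := rfl
    rw [ZZ.le_iff] at h
    have hp := p.fst_or
    have hq := q.fst_or
    have bp := emod_period_bounds (m := m) hn p.snd
    have bq := emod_period_bounds (m := m) hn q.snd
    have step : q.snd = p.snd + 1 → q.snd % period n m =
        if p.snd % period n m + 1 = period n m then 0 else p.snd % period n m + 1 := by
      intro e
      rw [e, ← Int.emod_add_emod]
      split_ifs with h1
      · rw [h1, Int.emod_self]
      · exact Int.emod_eq_of_lt (by omega) (by omega)
    have hcase : (q.snd = p.snd ∧ q.fst = p.fst) ∨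
        (p.fst = p.snd + 1 ∧ q.fst = q.snd ∧ q.snd = p.snd) ∨
        (p.fst = p.snd + 1 ∧ q.fst = q.snd ∧ q.snd = p.snd + 1) := by omega
    rcases hcase with ⟨h1, h2⟩ | ⟨h1, h2, h3⟩ | ⟨h1, h2, h3⟩
    · have : p = q := Subtype.ext (Prod.ext h2.symm h1.symm)
      rw [this]
    · change ((coveringFun hn p : Bipath n m).val ≤ (coveringFun hn q : Bipath n m).val ∧ _) ∨
        (_ ∧ (coveringFun hn q : Bipath n m).val ≤ (coveringFun hn p : Bipath n m).val) ∨ _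
      simp only [coveringFun, h1, h2, h3]
      split_ifs <;> omega
    · have s := step h3
      change ((coveringFun hn p : Bipath n m).val ≤ (coveringFun hn q : Bipath n m).val ∧ _) ∨
        (_ ∧ (coveringFun hn q : Bipath n m).val ≤ (coveringFun hn p : Bipath n m).val) ∨ _
      simp only [coveringFun, h1, h2]
      rw [h3] at s ⊢
      split_ifs at s ⊢ <;> omega

/-- The restriction functor `R : M ↦ M ∘ ζ`. -/
def restriction (k : Type u) [Field k] {n m : ℕ} (hn : 1 < n) (hm : 1 < m) :
    PersistenceModule k (Bipath n m) ⥤ PersistenceModule k ZZ :=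
  (Functor.whiskeringLeft ZZ (Bipath n m) (FGModuleCat.{u} k)).obj
    (covering hn hm).monotone.functor

end

end BipathPersistence

open BipathPersistence

namespace BipathPersistence

noncomputable section

/-! ### Interval decompositions by compatible bases -/

/-! A barcode amounts to bases of all the spaces that the internal maps carry to basis vectors or to
zero (`IntervalBasis`). Three facts about such bases give the theorem.

Uniqueness holds over every poset: a composite `k I → k I' → k I` with `I ≠ I'` is zero
(`coeff_mul_coeff`), so the change of basis between two decompositions stays invertible when
restricted to the summands on one fixed interval, and the multiplicities agree (`card_le`).

Existence over `B` uses only that `B` is finite, bounded and made of two chains meeting at the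
bounds (`TwoArms`). Every nonzero module has an interval summand, found according to whether the map
from bottom to top, or else the space at the bottom or at the top, is nonzero; induction on the
total dimension finishes.

For the restriction, a basis of `M` at `ζ x` serves at `x`, and a summand on `I` breaks up into the
connected components of `ζ⁻¹(I)`. Thus `R(M)` inherits a decomposition from `M`. Comparabilities of
`B` lift along `ζ`, so each component maps onto `I` (`IsComponent.image_eq`) and therefore
determines `I`; fibres of `ζ` are connected up to translation by multiples of `N`, so the components
over one `I` form a single `ℤ`-orbit (`IsComponent.exists_shift_eq`). Sending an interval to its
orbit of components is the bijection, and reading multiplicities off one component per interval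
recovers the arc code. -/

theorem PosetInterval.exists_boundary {P : Type} [PartialOrder P] (I : PosetInterval P)
    {S : Set P} {x y : P} (hx : x ∈ I.carrier) (hxS : x ∈ S) (hy : y ∈ I.carrier) (hyS : y ∉ S) :
    ∃ a b, a ∈ I.carrier ∧ a ∈ S ∧ b ∈ I.carrier ∧ b ∉ S ∧ (a ≤ b ∨ b ≤ a) := by
  by_contra! H
  have key : ∀ z, Relation.ReflTransGen
      (fun x y => x ∈ I.carrier ∧ y ∈ I.carrier ∧ (x ≤ y ∨ y ≤ x)) x z → z ∈ S := by
    intro z hz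
    induction hz with
    | refl => exact hxS
    | tail _ h ih =>
      by_contra hc
      exact h.2.2.elim (H _ _ h.1 ih h.2.1 hc).1 (H _ _ h.1 ih h.2.1 hc).2
  exact hyS (key y (I.connected hx hy))

/-- A property which passes along comparabilities inside an interval holds on all of it. -/
theorem PosetInterval.induction_on {P : Type} [PartialOrder P] (I : PosetInterval P)
    {S : P → Prop} {x : P} (hx : x ∈ I.carrier) (hxS : S x)
    (h : ∀ a b, a ∈ I.carrier → b ∈ I.carrier → S a → (a ≤ b ∨ b ≤ a) → S b)
    {y : P} (hy : y ∈ I.carrier) : S y := by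
  by_contra hyS
  obtain ⟨a, b, ha, haS, hb, hbS, hab⟩ := I.exists_boundary (S := {z | S z}) hx hxS hy hyS
  exact hbS (h a b ha hb haS hab)

section IntervalBasis

variable {k : Type u} [Field k] {P : Type} [PartialOrder P]

/-- The internal map of `F` from `p` to `q`, as a linear map. -/
def tr (F : P ⥤ ModuleCat.{u} k) {p q : P} (h : p ≤ q) : F.obj p →ₗ[k] F.obj q :=
  (F.map (homOfLE h)).hom

theorem tr_self (F : P ⥤ ModuleCat.{u} k) {p : P} (h : p ≤ p) (x : F.obj p) : tr F h x = x := by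
  simp [tr]

theorem tr_tr (F : P ⥤ ModuleCat.{u} k) {p q r : P} (h : p ≤ q) (h' : q ≤ r) (x : F.obj p) :
    tr F h' (tr F h x) = tr F (h.trans h') x := by
  have e : F.map (homOfLE (h.trans h')) = F.map (homOfLE h) ≫ F.map (homOfLE h') :=
    F.map_comp (homOfLE h) (homOfLE h')
  exact (LinearMap.congr_fun (congrArg ModuleCat.Hom.hom e) x).symm

theorem tr_comp (F : P ⥤ ModuleCat.{u} k) {p q r : P} (h : p ≤ q) (h' : q ≤ r) :
    tr F h' ∘ₗ tr F h = tr F (h.trans h') :=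
  LinearMap.ext fun x => tr_tr F h h' x

open Classical in
/-- A decomposition of `F` into interval modules, given by bases of all the spaces of `F` which
are compatible with the internal maps. -/
structure IntervalBasis (F : P ⥤ ModuleCat.{u} k) {J : Type} (I : J → PosetInterval P) where
  basis (p : P) : Module.Basis {j // p ∈ (I j).carrier} k (F.obj p)
  tr_basis {p q : P} (h : p ≤ q) (j : {j // p ∈ (I j).carrier}) :
    tr F h (basis p j) = if hq : q ∈ (I j.1).carrier then basis q ⟨j.1, hq⟩ else 0

namespace IntervalBasis

variable {F G : P ⥤ ModuleCat.{u} k} {J J' : Type} {I : J → PosetInterval P}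
  {I' : J' → PosetInterval P}

open Classical in
theorem repr_tr (b : IntervalBasis F I) {p q : P} (h : p ≤ q) (x : F.obj p)
    (j : {j // q ∈ (I j).carrier}) :
    (b.basis q).repr (tr F h x) j =
      if hp : p ∈ (I j.1).carrier then (b.basis p).repr x ⟨j.1, hp⟩ else 0 := by
  suffices H : (Finsupp.lapply j ∘ₗ (b.basis q).repr.toLinearMap) ∘ₗ tr F h =
      if hp : p ∈ (I j.1).carrier then
        Finsupp.lapply ⟨j.1, hp⟩ ∘ₗ (b.basis p).repr.toLinearMap else 0 by
    have := LinearMap.congr_fun H x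
    split_ifs at this ⊢ <;> exact this
  refine (b.basis p).ext fun i => ?_
  simp only [LinearMap.comp_apply, b.tr_basis]
  by_cases hj : i.1 = j.1
  · obtain ⟨i, hi⟩ := i
    obtain ⟨j, hq⟩ := j
    obtain rfl : i = j := hj
    simp [hi, hq]
  · split_ifs with h1 h2 h2
    · have e1 : (⟨i.1, h1⟩ : {j // q ∈ (I j).carrier}) ≠ j := fun e => hj (congrArg Subtype.val e)
      have e2 : i ≠ ⟨j.1, h2⟩ := fun e => hj (congrArg Subtype.val e)
      simp [e1, e2]
    · have e1 : (⟨i.1, h1⟩ : {j // q ∈ (I j).carrier}) ≠ j := fun e => hj (congrArg Subtype.val e)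
      simp [e1]
    · have e2 : i ≠ ⟨j.1, h2⟩ := fun e => hj (congrArg Subtype.val e)
      simp [e2]
    · simp

/-- Transport along an isomorphism. -/
def ofIso (b : IntervalBasis F I) (e : F ≅ G) : IntervalBasis G I where
  basis p := (b.basis p).map (e.app p).toLinearEquiv
  tr_basis {p q} h j := by
    have nat : tr G h ((e.app p).toLinearEquiv (b.basis p j)) =
        (e.app q).toLinearEquiv (tr F h (b.basis p j)) :=
      (LinearMap.congr_fun (congrArg ModuleCat.Hom.hom (e.hom.naturality (homOfLE h)))
        (b.basis p j)).symm
    rw [Module.Basis.map_apply, nat, b.tr_basis]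
    split_ifs <;> simp

/-- Modules with the same interval decomposition are isomorphic. -/
def iso (b : IntervalBasis F I) (c : IntervalBasis G I) : F ≅ G :=
  NatIso.ofComponents
    (fun p => ((b.basis p).equiv (c.basis p) (Equiv.refl _)).toModuleIso) (by
      intro p q f
      apply ModuleCat.hom_ext
      refine (b.basis p).ext fun j => ?_
      have hF := b.tr_basis (leOfHom f) j
      have hG := c.tr_basis (leOfHom f) j
      change ((b.basis q).equiv (c.basis q) (Equiv.refl _)) (tr F (leOfHom f) (b.basis p j)) =
        tr G (leOfHom f) (((b.basis p).equiv (c.basis p) (Equiv.refl _)) (b.basis p j))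
      rw [hF, Module.Basis.equiv_apply, Equiv.refl_apply, hG]
      split_ifs <;> simp)

/-- Reindexing of an interval decomposition. -/
def reindex (b : IntervalBasis F I) (σ : J ≃ J') (hσ : ∀ j, I' (σ j) = I j) :
    IntervalBasis F I' where
  basis p := (b.basis p).reindex (σ.subtypeEquiv fun j => by rw [hσ])
  tr_basis {p q} h := by
    rintro ⟨j', hj'⟩
    obtain ⟨j, rfl⟩ := σ.surjective j'
    have e : (σ.subtypeEquiv (p := fun j => p ∈ (I j).carrier)
        (q := fun j => p ∈ (I' j).carrier) fun j => by rw [hσ]).symm ⟨σ j, hj'⟩ =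
        ⟨j, by rwa [hσ] at hj'⟩ := by
      rw [Equiv.symm_apply_eq]; rfl
    rw [Module.Basis.reindex_apply, e, b.tr_basis]
    split_ifs with hq hq' hq'
    rotate_left
    · exact absurd ((hσ j).symm ▸ hq : q ∈ (I' (σ j)).carrier) hq'
    · exact absurd (hσ j ▸ hq' : q ∈ (I j).carrier) hq
    · rfl
    · rw [Module.Basis.reindex_apply]
      congr 1
      rw [Equiv.eq_symm_apply]; rfl

/-- The standard basis of the value at `p` of a direct sum of interval modules. -/
def sumBasis (k : Type u) [Field k] (I : J → PosetInterval P) (p : P) :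
    Module.Basis {j // p ∈ (I j).carrier} k
      (DirectSum J fun j => PLift (p ∈ (I j).carrier) → k) :=
  (DFinsupp.basis fun j => Pi.basisFun k (PLift (p ∈ (I j).carrier))).reindex
    (Equiv.sigmaPLiftEquivSubtype fun j => p ∈ (I j).carrier)

open Classical in
theorem sumBasis_apply (k : Type u) [Field k] (I : J → PosetInterval P) (p : P)
    (j : {j // p ∈ (I j).carrier}) :
    sumBasis k I p j =
      DirectSum.lof k J (fun j => PLift (p ∈ (I j).carrier) → k) j.1 fun _ => 1 := by
  obtain ⟨j, hj⟩ := j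
  have e : (Equiv.sigmaPLiftEquivSubtype fun j => p ∈ (I j).carrier).symm ⟨j, hj⟩ =
    ⟨j, ⟨hj⟩⟩ := rfl
  rw [sumBasis, Module.Basis.reindex_apply, e, Module.Basis.apply_eq_iff]
  ext ⟨i, hi⟩
  change (DirectSum.lof k J (fun j => PLift (p ∈ (I j).carrier) → k) j (fun _ => 1)) i hi = _
  rw [DirectSum.lof_eq_of]
  by_cases hij : i = j
  · subst hij
    rw [DirectSum.of_eq_same, Finsupp.single_apply, if_pos rfl]
  · rw [DirectSum.of_eq_of_ne _ _ _ hij, Finsupp.single_apply, if_neg]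
    · rfl
    · intro h
      exact hij (congrArg Sigma.fst h).symm

open Classical in
/-- The standard decomposition of a direct sum of interval modules. -/
def directSum (k : Type u) [Field k] (I : J → PosetInterval P) :
    IntervalBasis (directSum fun j => intervalModule k (I j)) I where
  basis p := sumBasis k I p
  tr_basis {p q} h := by
    rintro ⟨j, hj⟩
    change DirectSum.lmap (fun j => intervalMap k (I j) p q) (sumBasis k I p ⟨j, hj⟩) =
      if hq : q ∈ (I j).carrier then sumBasis k I q ⟨j, hq⟩ else 0
    have e : intervalMap k (I j) p q (fun _ => 1) = fun _ => 1 := funext fun _ => dif_pos hj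
    rw [sumBasis_apply, DirectSum.lmap_lof, e]
    split_ifs with hq
    · rw [sumBasis_apply]
    · have : (fun _ => 1 : PLift (q ∈ (I j).carrier) → k) = 0 := funext fun h => absurd h.down hq
      rw [this, map_zero]

/-! ### Uniqueness of the multiplicities -/

open Classical in
/-- The coordinate of a vector of the first decomposition with respect to the second one. -/
def coeff (b : IntervalBasis F I) (c : IntervalBasis F I') (p : P) (j : J) (l : J') : k :=
  if hj : p ∈ (I j).carrier then
    if hl : p ∈ (I' l).carrier then (c.basis p).repr (b.basis p ⟨j, hj⟩) ⟨l, hl⟩ else 0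
  else 0

theorem coeff_eq_zero_left {b : IntervalBasis F I} {c : IntervalBasis F I'} {p : P} {j : J}
    {l : J'} (h : p ∉ (I j).carrier) : coeff b c p j l = 0 := dif_neg h

theorem coeff_eq_zero_right {b : IntervalBasis F I} {c : IntervalBasis F I'} {p : P} {j : J}
    {l : J'} (h : p ∉ (I' l).carrier) : coeff b c p j l = 0 := by
  unfold coeff
  split_ifs <;> rfl

/-- Naturality of `k I → F → k I'`: both sides are the `l`-th coordinate of the `j`-th basis vector
after transport from `p` to `q`. The asymmetric membership is what is needed: if `q` leaves `I j` or
`p` is outside `I' l`, both sides vanish. -/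
theorem coeff_eq (b : IntervalBasis F I) (c : IntervalBasis F I') {p q : P} (h : p ≤ q) {j : J}
    {l : J'} (hp : p ∈ (I j).carrier) (hq : q ∈ (I' l).carrier) :
    coeff b c p j l = coeff b c q j l := by
  have e := c.repr_tr h (b.basis p ⟨j, hp⟩) ⟨l, hq⟩
  rw [b.tr_basis] at e
  unfold coeff
  rw [dif_pos hp]
  simp only [dif_pos hq]
  rw [← e]
  split_ifs <;> simp

/-- A composition `k I → k I' → k I` vanishes unless `I = I'`. -/
theorem coeff_mul_coeff (b : IntervalBasis F I) (c : IntervalBasis F I') {j j' : J} {l : J'}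
    (hj : I j' = I j) (hl : I' l ≠ I j) {p : P} (hp : p ∈ (I j).carrier) :
    coeff b c p j l * coeff c b p l j' = 0 := by
  have hmem : ∀ {x}, x ∈ (I j).carrier → x ∈ (I j').carrier := fun h => hj ▸ h
  -- The composite is a scalar which is constant along the connected set `I j`, so one zero
  -- suffices.
  suffices H : ∃ x ∈ (I j).carrier, coeff b c x j l * coeff c b x l j' = 0 by
    obtain ⟨x, hx, hx0⟩ := H
    have step : ∀ x y, x ∈ (I j).carrier → y ∈ (I j).carrier → x ≤ y →
        coeff b c x j l * coeff c b x l j' = coeff b c y j l * coeff c b y l j' := by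
      intro x y hx hy h
      by_cases hx' : x ∈ (I' l).carrier
      · have e := coeff_eq c b h hx' (hmem hy)
        by_cases hy' : y ∈ (I' l).carrier
        · rw [e, coeff_eq b c h hx hy']
        · rw [e, coeff_eq_zero_left hy', mul_zero, mul_zero]
      · by_cases hy' : y ∈ (I' l).carrier
        · rw [← coeff_eq b c h hx hy', coeff_eq_zero_right hx', zero_mul, zero_mul]
        · rw [coeff_eq_zero_right hx', coeff_eq_zero_right hy', zero_mul, zero_mul]
    refine (I j).induction_on (S := fun x => coeff b c x j l * coeff c b x l j' = 0) hx hx0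
      (fun x y hx hy h0 hxy => ?_) hp
    rcases hxy with hxy | hxy
    · exact (step x y hx hy hxy).symm.trans h0
    · exact (step y x hy hx hxy).trans h0
  by_cases hsub : ∃ x ∈ (I j).carrier, x ∉ (I' l).carrier
  · obtain ⟨x, hx, hx'⟩ := hsub
    exact ⟨x, hx, by rw [coeff_eq_zero_right hx', zero_mul]⟩
  · push Not at hsub
    obtain ⟨y, hy, hyI⟩ : ∃ y ∈ (I' l).carrier, y ∉ (I j).carrier := by
      by_contra! hc
      exact hl (PosetInterval.ext (Set.Subset.antisymm hc hsub))
    -- Here `I j` is a proper subset of `I' l`, and connectedness of the latter gives a comparable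
    -- pair across the boundary. Depending on its direction, naturality kills the first or the
    -- second factor at `x`.
    obtain ⟨x, y, hx, hxS, hy, hyS, hxy⟩ :=
      (I' l).exists_boundary (S := (I j).carrier) (hsub p hp) hp hy hyI
    refine ⟨x, hxS, ?_⟩
    rcases hxy with hxy | hxy
    · rw [coeff_eq b c hxy hxS hy, coeff_eq_zero_left hyS, zero_mul]
    · have hy0 : coeff c b y l j' = 0 := coeff_eq_zero_right (by rwa [hj])
      rw [← coeff_eq c b hxy hy (hmem hxS), hy0, mul_zero]

theorem finite_fiber [∀ p, Module.Finite k (F.obj p)] (b : IntervalBasis F I)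
    (I₀ : PosetInterval P) : Finite {j // I j = I₀} := by
  obtain ⟨p, hp⟩ := I₀.nonempty
  have := Module.Finite.finite_basis (b.basis p)
  exact Finite.of_injective
    (fun j : {j // I j = I₀} => (⟨j.1, by rwa [j.2]⟩ : {j // p ∈ (I j).carrier}))
    fun i j h => Subtype.ext (Subtype.mk.inj h)

-- At a point of `I₀` the full change-of-basis matrices are inverse to each other. Cut down to the
-- indices with interval `I₀` they still satisfy `A * C = 1`, and the rank of `A` is at most its
-- number of columns.
open Classical in
theorem card_le [∀ p, Module.Finite k (F.obj p)] (b : IntervalBasis F I) (c : IntervalBasis F I')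
    (I₀ : PosetInterval P) : Nat.card {j // I j = I₀} ≤ Nat.card {l // I' l = I₀} := by
  obtain ⟨p, hp⟩ := I₀.nonempty
  have := Module.Finite.finite_basis (b.basis p)
  have := Module.Finite.finite_basis (c.basis p)
  have := b.finite_fiber I₀
  have := c.finite_fiber I₀
  have := Fintype.ofFinite {j // p ∈ (I j).carrier}
  have := Fintype.ofFinite {l // p ∈ (I' l).carrier}
  have := Fintype.ofFinite {j // I j = I₀}
  have := Fintype.ofFinite {l // I' l = I₀}
  let A : Matrix {j // I j = I₀} {l // I' l = I₀} k := fun j l => coeff b c p j.1 l.1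
  let C : Matrix {l // I' l = I₀} {j // I j = I₀} k := fun l j => coeff c b p l.1 j.1
  have hAC : A * C = 1 := by
    ext ⟨j, rfl⟩ ⟨j', hj'⟩
    have hp' : p ∈ (I j').carrier := hj'.symm ▸ hp
    have e : ∑ l : {l // p ∈ (I' l).carrier}, coeff b c p j l.1 * coeff c b p l.1 j' =
        if j = j' then 1 else 0 := by
      have e1 := congrArg (fun x => (b.basis p).repr x ⟨j', hp'⟩)
        ((c.basis p).sum_repr (b.basis p ⟨j, hp⟩))
      simp only [map_sum, map_smul, Finsupp.coe_finsetSum, Finset.sum_apply, Finsupp.smul_apply,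
        smul_eq_mul, Module.Basis.repr_self, Finsupp.single_apply, Subtype.mk.injEq] at e1
      rw [← e1]
      refine Finset.sum_congr rfl fun l _ => ?_
      unfold coeff
      rw [dif_pos hp, dif_pos l.2, dif_pos l.2, dif_pos hp']
    rw [Matrix.mul_apply, Matrix.one_apply]
    simp only [Subtype.mk.injEq]
    rw [← e]
    -- The terms with `I' l ≠ I₀` that are dropped from the full sum vanish by `coeff_mul_coeff`.
    refine Finset.sum_of_injOn (fun l => ⟨l.1, by rwa [l.2]⟩) ?_ ?_ ?_ ?_
    · intro l _ l' _ h
      exact Subtype.ext (Subtype.mk.inj h)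
    · simp [Set.MapsTo]
    · rintro ⟨l, hl⟩ - h
      refine coeff_mul_coeff b c hj' (fun hl' => h ?_) hp
      exact ⟨⟨l, hl'⟩, by simp, rfl⟩
    · intro l _
      rfl
  rw [Nat.card_eq_fintype_card, Nat.card_eq_fintype_card]
  calc Fintype.card {j // I j = I₀} = (A * C).rank := by rw [hAC, Matrix.rank_one]
    _ ≤ A.rank := Matrix.rank_mul_le_left A C
    _ ≤ _ := Matrix.rank_le_card_width A

end IntervalBasis

/-! ### Barcodes read off from compatible bases -/

theorem hasBarcode_iff {M : PersistenceModule k P} {μ : PosetInterval P → ℕ} :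
    HasBarcode M μ ↔ Nonempty (IntervalBasis (M ⋙ forget₂ (FGModuleCat.{u} k) (ModuleCat.{u} k))
      fun j : (Σ I : PosetInterval P, Fin (μ I)) => j.1) :=
  ⟨fun ⟨e⟩ => ⟨(IntervalBasis.directSum k _).ofIso e.symm⟩,
    fun ⟨b⟩ => ⟨b.iso (IntervalBasis.directSum k _)⟩⟩

instance (M : PersistenceModule k P) (p : P) : Module.Finite k
    ((M ⋙ forget₂ (FGModuleCat.{u} k) (ModuleCat.{u} k)).obj p) :=
  (M.obj p).property

theorem card_sigma_fst (μ : PosetInterval P → ℕ) (I : PosetInterval P) :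
    Nat.card {j : (Σ I : PosetInterval P, Fin (μ I)) // j.1 = I} = μ I := by
  rw [Nat.card_congr (Equiv.sigmaSubtype I), Nat.card_fin]

/-- The barcode of a module is read off from any interval decomposition. -/
theorem IntervalBasis.hasBarcode {M : PersistenceModule k P} {J : Type} {I : J → PosetInterval P}
    (b : IntervalBasis (M ⋙ forget₂ (FGModuleCat.{u} k) (ModuleCat.{u} k)) I) :
    HasBarcode M fun I₀ => Nat.card {j // I j = I₀} := by
  have := b.finite_fiber
  refine hasBarcode_iff.2 ⟨b.reindex ((Equiv.sigmaFiberEquiv I).symm.trans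
    (Equiv.sigmaCongrRight fun I₀ => Finite.equivFin _)) fun j => rfl⟩

theorem HasBarcode.unique {M : PersistenceModule k P} {μ ν : PosetInterval P → ℕ}
    (hμ : HasBarcode M μ) (hν : HasBarcode M ν) : μ = ν := by
  obtain ⟨b⟩ := hasBarcode_iff.1 hμ
  obtain ⟨c⟩ := hasBarcode_iff.1 hν
  funext I
  have h := b.card_le c I
  have h' := c.card_le b I
  rw [card_sigma_fst, card_sigma_fst] at h h'
  exact le_antisymm h h'

theorem HasBarcode.barcode_eq {M : PersistenceModule k P} {μ : PosetInterval P → ℕ}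
    (hμ : HasBarcode M μ) : barcode M = μ := by
  have h : ∃ μ, HasBarcode M μ := ⟨μ, hμ⟩
  rw [barcode, dif_pos h]
  exact h.choose_spec.unique hμ

theorem HasBarcode.of_iso {M M' : PersistenceModule k P} {μ : PosetInterval P → ℕ}
    (e : M ≅ M') (h : HasBarcode M μ) : HasBarcode M' μ :=
  h.map fun f => (Functor.isoWhiskerRight e _).symm ≪≫ f

theorem HasBarcode.nonempty_iso {M M' : PersistenceModule k P} {μ : PosetInterval P → ℕ}
    (h : HasBarcode M μ) (h' : HasBarcode M' μ) : Nonempty (M ≅ M') := by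
  obtain ⟨f⟩ := h
  obtain ⟨f'⟩ := h'
  let F := (Functor.whiskeringRight P _ _).obj (forget₂ (FGModuleCat.{u} k) (ModuleCat.{u} k))
  -- Whiskering with the fully faithful forgetful functor is fully faithful, so the isomorphism
  -- lifts.
  exact ⟨F.preimageIso (f ≪≫ f'.symm)⟩

end IntervalBasis

section Existence

variable {k : Type u} [Field k] {P : Type} [PartialOrder P]

/-! ### Splitting off interval modules -/

/-- Morphisms `k I → F → k I`, given by vectors and functionals, with composition the identity. -/
structure IntervalSplitting (F : P ⥤ ModuleCat.{u} k) (I : PosetInterval P) where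
  vec (p : P) : F.obj p
  dual (p : P) : F.obj p →ₗ[k] k
  vec_eq_zero {p : P} : p ∉ I.carrier → vec p = 0
  dual_eq_zero {p : P} : p ∉ I.carrier → dual p = 0
  tr_vec {p q : P} (h : p ≤ q) : p ∈ I.carrier → tr F h (vec p) = vec q
  dual_tr {p q : P} (h : p ≤ q) : q ∈ I.carrier → ∀ x, dual q (tr F h x) = dual p x
  dual_vec {p : P} : p ∈ I.carrier → dual p (vec p) = 1

namespace IntervalSplitting

variable {F : P ⥤ ModuleCat.{u} k} {I : PosetInterval P}

theorem tr_mem_ker (s : IntervalSplitting F I) {p q : P} (h : p ≤ q) (x : F.obj p)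
    (hx : x ∈ LinearMap.ker (s.dual p)) : tr F h x ∈ LinearMap.ker (s.dual q) := by
  rw [LinearMap.mem_ker] at hx ⊢
  by_cases hq : q ∈ I.carrier
  · rw [s.dual_tr h hq, hx]
  · rw [s.dual_eq_zero hq, LinearMap.zero_apply]

/-- The complement of the interval module split off. -/
def complement (s : IntervalSplitting F I) : P ⥤ ModuleCat.{u} k where
  obj p := ModuleCat.of k (LinearMap.ker (s.dual p))
  map {p q} f := ModuleCat.ofHom ((tr F (leOfHom f)).restrict (s.tr_mem_ker (leOfHom f)))
  map_id p := by
    apply ModuleCat.hom_ext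
    ext x
    exact tr_self F le_rfl x.1
  map_comp f g := by
    apply ModuleCat.hom_ext
    ext x
    exact (tr_tr F (leOfHom f) (leOfHom g) x.1).symm

open Classical in
/-- The vector space decomposition at `p`. -/
def equiv (s : IntervalSplitting F I) (p : P) :
    F.obj p ≃ₗ[k] LinearMap.ker (s.dual p) × (PLift (p ∈ I.carrier) → k) where
  toFun x := (⟨x - s.dual p x • s.vec p, by
    rw [LinearMap.mem_ker]
    by_cases hp : p ∈ I.carrier
    · simp [s.dual_vec hp]
    · simp [s.dual_eq_zero hp]⟩, fun _ => s.dual p x)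
  map_add' x y := by
    ext
    · simp [add_smul]; abel
    · simp
  map_smul' c x := by
    ext
    · simp [smul_sub, mul_smul]
    · simp
  invFun y := y.1.1 + if hp : p ∈ I.carrier then y.2 ⟨hp⟩ • s.vec p else 0
  left_inv x := by
    split_ifs with hp
    · simp
    · simp [s.dual_eq_zero hp]
  right_inv := by
    rintro ⟨⟨y, hy⟩, c⟩
    rw [LinearMap.mem_ker] at hy
    by_cases hp : p ∈ I.carrier
    · ext
      · simp [hp, hy, s.dual_vec hp]
      · simp [hp, hy, s.dual_vec hp]
    · ext h
      · simp [hp, s.dual_eq_zero hp]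
      · exact absurd h.down hp

/-- The indices of the intervals at `p` in the decomposition extended by `I`. -/
def indexEquiv {J : Type} (I' : J → PosetInterval P) (I : PosetInterval P) (p : P) :
    {j // p ∈ (I' j).carrier} ⊕ PLift (p ∈ I.carrier) ≃
      {j : J ⊕ Unit // p ∈ (Sum.elim I' (fun _ => I) j).carrier} where
  toFun := Sum.elim (fun j => ⟨Sum.inl j.1, j.2⟩) fun h => ⟨Sum.inr (), h.down⟩
  invFun
    | ⟨Sum.inl j, h⟩ => Sum.inl ⟨j, h⟩
    | ⟨Sum.inr _, h⟩ => Sum.inr ⟨h⟩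
  left_inv := by rintro (j | h) <;> rfl
  right_inv := by rintro ⟨j | j, h⟩ <;> rfl

/-- The basis of `F` at `p` extending a basis of the complement. -/
def extendBasis (s : IntervalSplitting F I) {ι : Type} (p : P)
    (b : Module.Basis ι k (LinearMap.ker (s.dual p))) :
    Module.Basis (ι ⊕ PLift (p ∈ I.carrier)) k (F.obj p) :=
  (b.prod (Pi.basisFun k (PLift (p ∈ I.carrier)))).map (s.equiv p).symm

theorem extendBasis_inl (s : IntervalSplitting F I) {ι : Type} (p : P)
    (b : Module.Basis ι k (LinearMap.ker (s.dual p))) (i : ι) :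
    s.extendBasis p b (Sum.inl i) = b i := by
  rw [extendBasis, Module.Basis.map_apply, LinearEquiv.symm_apply_eq]
  have h : s.dual p (b i) = 0 := (b i).2
  ext
  · simp [equiv, h]
  · simp [equiv, h]

theorem extendBasis_inr (s : IntervalSplitting F I) {ι : Type} (p : P)
    (b : Module.Basis ι k (LinearMap.ker (s.dual p))) (h : PLift (p ∈ I.carrier)) :
    s.extendBasis p b (Sum.inr h) = s.vec p := by
  rw [extendBasis, Module.Basis.map_apply, LinearEquiv.symm_apply_eq]
  ext i
  · simp [equiv, s.dual_vec h.down]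
  · simp [equiv, s.dual_vec h.down, Subsingleton.elim i h]

open Classical in
/-- An interval decomposition of the complement extends to `F`. -/
def extend (s : IntervalSplitting F I) {J : Type} {I' : J → PosetInterval P}
    (b : IntervalBasis s.complement I') : IntervalBasis F (Sum.elim I' fun _ : Unit => I) where
  basis p := (s.extendBasis p (b.basis p)).reindex (indexEquiv I' I p)
  tr_basis {p q} h := by
    have inl : ∀ p (j : {j // p ∈ (I' j).carrier}),
        (s.extendBasis p (b.basis p)).reindex (indexEquiv I' I p) ⟨Sum.inl j.1, j.2⟩ =
        (show LinearMap.ker (s.dual p) from b.basis p j).1 := fun p j =>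
      ((s.extendBasis p (b.basis p)).reindex_apply _ _).trans (s.extendBasis_inl p _ j)
    have inr : ∀ p (h : p ∈ I.carrier),
        (s.extendBasis p (b.basis p)).reindex (indexEquiv I' I p) ⟨Sum.inr (), h⟩ =
          s.vec p := fun p h =>
      ((s.extendBasis p (b.basis p)).reindex_apply _ _).trans (s.extendBasis_inr p _ ⟨h⟩)
    rintro ⟨j | j, hj⟩
    · rw [inl p ⟨j, hj⟩]
      refine (congrArg Subtype.val (b.tr_basis h ⟨j, hj⟩)).trans ?_
      change _ = if hq : q ∈ (I' j).carrier then _ else 0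
      split_ifs with hq
      · exact (inl q ⟨j, hq⟩).symm
      · rfl
    · rw [inr p hj, s.tr_vec h hj]
      change _ = if hq : q ∈ I.carrier then _ else 0
      split_ifs with hq
      · exact (inr q hq).symm
      · exact s.vec_eq_zero hq

end IntervalSplitting

/-- Induction on the total dimension. At a point of the split interval the functional takes the
value 1 on the vector, so its kernel is proper and the complement is strictly smaller. -/
theorem exists_intervalBasis_of_splitting [Finite P]
    (H : ∀ F : P ⥤ ModuleCat.{u} k, (∀ p, Module.Finite k (F.obj p)) →
      (∃ p, Nontrivial (F.obj p)) → ∃ I, Nonempty (IntervalSplitting F I))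
    (F : P ⥤ ModuleCat.{u} k) (hF : ∀ p, Module.Finite k (F.obj p)) :
    ∃ (J : Type) (I : J → PosetInterval P), Nonempty (IntervalBasis F I) := by
  have := Fintype.ofFinite P
  induction hd : ∑ p, Module.finrank k (F.obj p) using Nat.strong_induction_on generalizing F with
  | _ d ih =>
    by_cases hnt : ∃ p, Nontrivial (F.obj p)
    · obtain ⟨I, ⟨s⟩⟩ := H F hF hnt
      have hlt : ∑ p, Module.finrank k (s.complement.obj p) < d := by
        obtain ⟨p, hp⟩ := I.nonempty
        rw [← hd]
        refine Finset.sum_lt_sum (fun q _ => Submodule.finrank_le (LinearMap.ker (s.dual q)))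
          ⟨p, Finset.mem_univ p, Submodule.finrank_lt (s := LinearMap.ker (s.dual p)) ?_⟩
        intro h
        have h1 := s.dual_vec hp
        rw [LinearMap.ker_eq_top.1 h] at h1
        simp at h1
      obtain ⟨J, I', ⟨b⟩⟩ := ih _ hlt s.complement
        (fun p => inferInstanceAs (Module.Finite k (LinearMap.ker (s.dual p)))) rfl
      exact ⟨_, _, ⟨s.extend b⟩⟩
    · push Not at hnt
      have : ∀ p, Subsingleton (F.obj p) := fun p => by
        simpa [not_nontrivial_iff_subsingleton] using hnt p
      exact ⟨Empty, Empty.elim, ⟨⟨fun p => Module.Basis.empty _, fun h j => j.1.elim⟩⟩⟩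

end Existence

/-! ### Interval summands over a bounded poset with two arms -/

section Splittings

variable {k : Type u} [Field k] {P : Type} [PartialOrder P]

/-- A set with an element comparable to all the others is connected. -/
def PosetInterval.ofCenter (S : Set P) (c : P) (hc : c ∈ S)
    (convex : ∀ ⦃p z q : P⦄, p ∈ S → q ∈ S → p ≤ z → z ≤ q → z ∈ S)
    (center : ∀ p ∈ S, c ≤ p ∨ p ≤ c) : PosetInterval P where
  carrier := S
  nonempty := ⟨c, hc⟩
  convex := convex
  connected p q hp hq :=
    (Relation.ReflTransGen.single ⟨hp, hc, (center p hp).symm⟩).tail ⟨hc, hq, center q hq⟩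

/-- A bounded poset consisting of two chains which only share comparabilities through the bounds. -/
structure TwoArms (P : Type) [PartialOrder P] where
  bot : P
  top : P
  bot_le (p : P) : bot ≤ p
  le_top (p : P) : p ≤ top
  arm : P → Bool
  total {p q : P} : arm p = arm q → p ≤ q ∨ q ≤ p
  cross {p q : P} : p ≤ q → p = bot ∨ q = top ∨ arm p = arm q

namespace TwoArms

/-- If `I` has no element on the arm `c`, the bottom element serves as a default, and the bound is
vacuous. -/
theorem exists_max [Finite P] (A : TwoArms P) {I : Set P} (h : A.bot ∈ I) (c : Bool) :
    ∃ a ∈ I, (∀ p ∈ I, A.arm p = c → p ≤ a) ∧ (a = A.bot ∨ A.arm a = c) := by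
  by_cases hne : {p | p ∈ I ∧ A.arm p = c}.Nonempty
  · obtain ⟨a, ha, hmax⟩ := (Set.toFinite {p | p ∈ I ∧ A.arm p = c}).exists_maximal hne
    refine ⟨a, ha.1, fun p hp hc => ?_, Or.inr ha.2⟩
    exact (A.total (hc.trans ha.2.symm)).elim id fun h => hmax ⟨hp, hc⟩ h
  · exact ⟨A.bot, h, fun p hp hc => absurd ⟨p, hp, hc⟩ hne, Or.inl rfl⟩

theorem exists_min [Finite P] (A : TwoArms P) {I : Set P} (h : A.top ∈ I) (c : Bool) :
    ∃ a ∈ I, (∀ p ∈ I, A.arm p = c → a ≤ p) ∧ (a = A.top ∨ A.arm a = c) := by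
  by_cases hne : {p | p ∈ I ∧ A.arm p = c}.Nonempty
  · obtain ⟨a, ha, hmin⟩ := (Set.toFinite {p | p ∈ I ∧ A.arm p = c}).exists_minimal hne
    refine ⟨a, ha.1, fun p hp hc => ?_, Or.inr ha.2⟩
    exact (A.total (ha.2.trans hc.symm)).elim id fun h => hmin ⟨hp, hc⟩ h
  · exact ⟨A.top, h, fun p hp hc => absurd ⟨p, hp, hc⟩ hne, Or.inl rfl⟩

theorem exists_dual_eq_one {V : Type*} [AddCommGroup V] [Module k V] {W : Submodule k V} {x : V}
    (hx : x ∉ W) : ∃ f : V →ₗ[k] k, f x = 1 ∧ ∀ y ∈ W, f y = 0 := by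
  obtain ⟨f, hf, hW⟩ := Submodule.exists_le_ker_of_notMem hx
  exact ⟨(f x)⁻¹ • f, by simp [hf], fun y hy => by simp [show f y = 0 from hW hy]⟩

/-- The range of the dual map of `T` is the annihilator of the kernel of `T`. -/
theorem exists_dual_comp_eq {V W : Type*} [AddCommGroup V] [Module k V] [AddCommGroup W]
    [Module k W] (T : V →ₗ[k] W) (f : V →ₗ[k] k) (h : ∀ x, T x = 0 → f x = 0) :
    ∃ g : W →ₗ[k] k, ∀ x, g (T x) = f x := by
  have : f ∈ LinearMap.range T.dualMap := by
    rw [LinearMap.range_dualMap_eq_dualAnnihilator_ker, Submodule.mem_dualAnnihilator]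
    exact h
  obtain ⟨g, hg⟩ := this
  exact ⟨g, LinearMap.congr_fun hg⟩

/-- A nonzero map from bottom to top splits off the whole poset. -/
theorem exists_splitting_whole (A : TwoArms P) (F : P ⥤ ModuleCat.{u} k)
    (h : tr F (A.bot_le A.top) ≠ 0) :
    ∃ I, Nonempty (IntervalSplitting F I) := by
  obtain ⟨v, hv⟩ : ∃ v, tr F (A.bot_le A.top) v ≠ 0 := by
    by_contra! hc
    exact h (LinearMap.ext hc)
  obtain ⟨w, hw, -⟩ := exists_dual_eq_one (k := k) (W := ⊥)
    (show tr F (A.bot_le A.top) v ∉ ⊥ by simpa using hv)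
  refine ⟨.ofCenter Set.univ A.bot trivial (fun _ _ _ _ _ _ _ => trivial)
    (fun p _ => Or.inl (A.bot_le p)), ⟨?_⟩⟩
  exact
  { vec p := tr F (A.bot_le p) v
    dual p := w ∘ₗ tr F (A.le_top p)
    vec_eq_zero h := absurd trivial h
    dual_eq_zero h := absurd trivial h
    tr_vec h _ := tr_tr F _ _ _
    dual_tr h _ x := by simp [tr_tr]
    dual_vec _ := by simp [tr_tr, hw] }

open Classical in
/-- If the map from bottom to top vanishes, a nonzero space at the bottom splits off an interval
containing the bottom. -/
theorem exists_splitting_bot [Finite P] (A : TwoArms P) (F : P ⥤ ModuleCat.{u} k)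
    (h0 : tr F (A.bot_le A.top) = 0)
    (hnt : Nontrivial (F.obj A.bot)) : ∃ I, Nonempty (IntervalSplitting F I) := by
  -- `S v` is the support of the submodule generated by `v`, a down-set. The vector chosen next is
  -- nonzero with the fewest support points on the arm `true`.
  let S : F.obj A.bot → Set P := fun v => {p | tr F (A.bot_le p) v ≠ 0}
  have hS : ∀ v p q, p ≤ q → q ∈ S v → p ∈ S v := by
    intro v p q h hq hp
    exact hq (by rw [← tr_tr F (A.bot_le p) h, hp, map_zero])
  obtain ⟨v, hv, hmin⟩ := (measure fun v => (S v ∩ {p | A.arm p = true}).ncard).wf.has_min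
    {v | v ≠ 0} (exists_ne 0)
  have hbot : A.bot ∈ S v := by
    change tr F _ v ≠ 0
    rwa [tr_self]
  have htop : A.top ∉ S v := fun h => h (by rw [h0, LinearMap.zero_apply])
  choose a haS hamax ha using fun c => A.exists_max hbot c
  -- A nonzero `x` killed at `a true` would have its support on this arm inside that of `v` with `a
  -- true` missing, against minimality.
  have hinj : ∀ x, tr F (A.bot_le (a true)) x = 0 → x = 0 := by
    intro x hx
    rcases ha true with e | e
    · have : ∀ b, b = A.bot → tr F (A.bot_le b) x = 0 → x = 0 := by
        rintro b rfl h
        rwa [tr_self] at h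
      exact this _ e hx
    · by_contra hx0
      refine hmin x hx0 (Set.ncard_lt_ncard ⟨?_, ?_⟩ (Set.toFinite _))
      · rintro p ⟨hp, hpc⟩
        refine ⟨?_, hpc⟩
        rcases A.total (hpc.trans e.symm) with h | h
        · exact hS v _ _ h (haS true)
        · exact absurd (by rw [← tr_tr F (A.bot_le _) h, hx, map_zero]) hp
      · intro h
        exact (h ⟨haS true, e⟩).1 hx
  -- A single functional at the bottom has to factor through both `F (a c)`, so that the functionals
  -- on the two arms agree there: for `false` because it kills the kernel, for `true` by
  -- injectivity.
  obtain ⟨w₀, hw₀v, hw₀⟩ := exists_dual_eq_one (k := k)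
    (W := LinearMap.ker (tr F (A.bot_le (a false)))) (x := v) (haS false)
  have hw : ∀ c, ∃ w : F.obj (a c) →ₗ[k] k, ∀ x, w (tr F (A.bot_le (a c)) x) = w₀ x := by
    intro c
    refine exists_dual_comp_eq _ _ fun x hx => ?_
    cases c
    · exact hw₀ x hx
    · rw [hinj x hx, map_zero]
  choose w hw using hw
  refine ⟨.ofCenter (S v) A.bot hbot (fun _ _ _ _ hq _ h => hS v _ _ h hq)
    (fun p _ => Or.inl (A.bot_le p)), ⟨?_⟩⟩
  exact
  { vec p := tr F (A.bot_le p) v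
    dual p := if hp : p ∈ S v then w (A.arm p) ∘ₗ tr F (hamax _ p hp rfl) else 0
    vec_eq_zero h := not_not.1 h
    dual_eq_zero h := dif_neg h
    tr_vec h _ := tr_tr F _ _ _
    dual_tr {p q} h hq x := by
      have hq' : q ∈ S v := hq
      have hp' : p ∈ S v := hS v p q h hq
      simp only [dif_pos hq', dif_pos hp', LinearMap.comp_apply, tr_tr]
      rcases A.cross h with rfl | rfl | e
      · rw [hw, hw]
      · exact absurd hq htop
      · have : ∀ c c', c = c' → ∀ (hc : p ≤ a c) (hc' : p ≤ a c'),
            w c (tr F hc x) = w c' (tr F hc' x) := by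
          rintro c _ rfl _ _
          rfl
        exact this _ _ e.symm _ _
    dual_vec {p} hp := by
      have hp' : p ∈ S v := hp
      simp only [dif_pos hp', LinearMap.comp_apply, tr_tr]
      rw [hw, hw₀v] }

open Classical in
/-- If the map from bottom to top vanishes, a nonzero space at the top splits off an interval
containing the top. -/
theorem exists_splitting_top [Finite P] (A : TwoArms P) (F : P ⥤ ModuleCat.{u} k)
    (h0 : tr F (A.bot_le A.top) = 0)
    (hnt : Nontrivial (F.obj A.top)) : ∃ I, Nonempty (IntervalSplitting F I) := by
  -- The dual of the argument at the bottom: supports of functionals at the top are up-sets, and `w`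
  -- is chosen with minimal support on the arm `true`.
  let S : (F.obj A.top →ₗ[k] k) → Set P := fun w => {p | w ∘ₗ tr F (A.le_top p) ≠ 0}
  have hS : ∀ w p q, p ≤ q → p ∈ S w → q ∈ S w := by
    intro w p q h hp hq
    exact hp (by rw [← tr_comp F h (A.le_top q), ← LinearMap.comp_assoc, hq, LinearMap.zero_comp])
  obtain ⟨w, hw, hmin⟩ := (measure fun w => (S w ∩ {p | A.arm p = true}).ncard).wf.has_min
    {w | w ≠ 0} (by
      obtain ⟨x, hx⟩ := exists_ne (0 : F.obj A.top)
      obtain ⟨f, hf, -⟩ := exists_dual_eq_one (k := k) (W := ⊥) (x := x) (by simpa using hx)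
      exact ⟨f, fun h => by simp [h] at hf⟩)
  have htop : A.top ∈ S w := by
    intro h
    exact hw (LinearMap.ext fun x => by simpa [tr_self] using LinearMap.congr_fun h x)
  have hbot : A.bot ∉ S w := fun h => h (by rw [h0, LinearMap.comp_zero])
  choose a haS hamin ha using fun c => A.exists_min htop c
  -- Otherwise a nonzero functional vanishing on the image from `a true` would have smaller support
  -- on this arm.
  have hsurj : ∀ x, ∃ y, tr F (A.le_top (a true)) y = x := by
    intro x
    rcases ha true with e | e
    · have : ∀ b (hb : b = A.top), ∃ y, tr F (A.le_top b) y = x := by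
        rintro b rfl
        exact ⟨x, tr_self F _ x⟩
      exact this _ e
    · by_contra hx
      obtain ⟨f, hf, hf0⟩ := exists_dual_eq_one (k := k)
        (W := LinearMap.range (tr F (A.le_top (a true)))) (x := x) hx
      have hfa : f ∘ₗ tr F (A.le_top (a true)) = 0 :=
        LinearMap.ext fun y => hf0 _ ⟨y, rfl⟩
      refine hmin f (fun h => by simp [h] at hf) (Set.ncard_lt_ncard ⟨?_, ?_⟩ (Set.toFinite _))
      · rintro p ⟨hp, hpc⟩
        refine ⟨?_, hpc⟩
        rcases A.total (e.trans hpc.symm) with h | h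
        · exact hS w _ _ h (haS true)
        · exact absurd (by rw [← tr_comp F h (A.le_top _), ← LinearMap.comp_assoc, hfa,
            LinearMap.zero_comp]) hp
      · intro h
        exact (h ⟨haS true, e⟩).1 hfa
  obtain ⟨y₀, hy₀⟩ : ∃ y, w (tr F (A.le_top (a false)) y) = 1 := by
    obtain ⟨y, hy⟩ : ∃ y, w (tr F (A.le_top (a false)) y) ≠ 0 := by
      by_contra! hc
      exact haS false (LinearMap.ext hc)
    exact ⟨(w (tr F (A.le_top (a false)) y))⁻¹ • y, by simp [hy]⟩
  -- The vectors starting the two arms must have the same image at the top: `y₀` fixes it from the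
  -- arm `false`, and surjectivity lifts it to `a true`.
  have hv : ∀ c, ∃ y, tr F (A.le_top (a c)) y = tr F (A.le_top (a false)) y₀ := by
    intro c
    cases c
    · exact ⟨y₀, rfl⟩
    · exact hsurj _
  choose v hv using hv
  refine ⟨.ofCenter (S w) A.top htop (fun _ _ _ hp _ h _ => hS w _ _ h hp)
    (fun p _ => Or.inr (A.le_top p)), ⟨?_⟩⟩
  exact
  { vec p := if hp : p ∈ S w then tr F (hamin _ p hp rfl) (v (A.arm p)) else 0
    dual p := w ∘ₗ tr F (A.le_top p)
    vec_eq_zero h := dif_neg h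
    dual_eq_zero h := not_not.1 h
    tr_vec {p q} h hp := by
      have hp' : p ∈ S w := hp
      have hq' : q ∈ S w := hS w p q h hp
      simp only [dif_pos hq', dif_pos hp', tr_tr]
      rcases A.cross h with rfl | rfl | e
      · exact absurd hp hbot
      · rw [hv, hv]
      · have : ∀ c c', c = c' → ∀ (hc : a c ≤ q) (hc' : a c' ≤ q),
            tr F hc (v c) = tr F hc' (v c') := by
          rintro c _ rfl _ _
          rfl
        exact this _ _ e _ _
    dual_tr h _ x := by simp [tr_tr]
    dual_vec {p} hp := by
      have hp' : p ∈ S w := hp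
      simp only [dif_pos hp', LinearMap.comp_apply, tr_tr]
      rw [hv, hy₀] }

open Classical in
/-- A nonzero module which vanishes at bottom and top splits off an interval inside an arm. -/
theorem exists_splitting_interior [Finite P] (A : TwoArms P) (F : P ⥤ ModuleCat.{u} k)
    (hbot : Subsingleton (F.obj A.bot))
    (htop : Subsingleton (F.obj A.top)) (hnt : ∃ p, Nontrivial (F.obj p)) :
    ∃ I, Nonempty (IntervalSplitting F I) := by
  obtain ⟨x, hx, hxmin⟩ := (Set.toFinite {p | Nontrivial (F.obj p)}).exists_minimal hnt
  obtain ⟨y, ⟨hxy, hy⟩, hymax⟩ := (Set.toFinite {q | ∃ h : x ≤ q, tr F h ≠ 0}).exists_maximal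
    ⟨x, le_rfl, fun h => by
      have : Nontrivial (F.obj x) := hx
      obtain ⟨v, hv⟩ := exists_ne (0 : F.obj x)
      exact hv (by rw [← tr_self F le_rfl v, h, LinearMap.zero_apply])⟩
  obtain ⟨v, hv⟩ : ∃ v, tr F hxy v ≠ 0 := by
    by_contra! hc
    exact hy (LinearMap.ext hc)
  obtain ⟨w, hw, -⟩ := exists_dual_eq_one (k := k) (W := ⊥)
    (show tr F hxy v ∉ ⊥ by simpa using hv)
  have hxbot : x ≠ A.bot := by
    rintro rfl
    exact not_nontrivial_iff_subsingleton.2 hbot hx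
  have hytop : y ≠ A.top := by
    rintro rfl
    exact hv (Subsingleton.elim _ _)
  have harm : ∀ {p q}, p ≠ A.bot → q ≠ A.top → p ≤ q → A.arm p = A.arm q := by
    intro p q hp hq h
    rcases A.cross h with h | h | h
    · exact absurd h hp
    · exact absurd h hq
    · exact h
  have hnbot : ∀ {p}, x ≤ p → p ≠ A.bot := by
    rintro p h rfl
    exact hxbot (le_antisymm h (A.bot_le x))
  have hntop : ∀ {p}, p ≤ y → p ≠ A.top := by
    rintro p h rfl
    exact hytop (le_antisymm (A.le_top y) h)
  -- Such a `q` is the top, where the space is zero, or lies beyond `y` on the same arm, where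
  -- maximality of `y` applies.
  have htr : ∀ {q} (h : x ≤ q), ¬ q ≤ y → tr F h v = 0 := by
    intro q h hq
    by_cases hqt : q = A.top
    · subst hqt
      exact Subsingleton.elim _ _
    have e : A.arm q = A.arm y :=
      (harm hxbot hqt h).symm.trans (harm hxbot hytop hxy)
    by_contra hne
    exact hq ((A.total e).elim id fun hyq => hymax ⟨h, fun h0 => hne (by rw [h0]; rfl)⟩ hyq)
  -- Such a `p` is the bottom, or lies below `x` on the same arm, where minimality of `x` applies.
  have hsub : ∀ {p}, p ≤ y → ¬ x ≤ p → Subsingleton (F.obj p) := by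
    intro p h hp
    by_cases hpb : p = A.bot
    · rwa [hpb]
    have e : A.arm p = A.arm x :=
      (harm hpb hytop h).trans (harm hxbot hytop hxy).symm
    by_contra hne
    rw [not_subsingleton_iff_nontrivial] at hne
    exact hp ((A.total e).elim (fun hpx => hxmin hne hpx) id)
  refine ⟨.ofCenter (Set.Icc x y) x ⟨le_rfl, hxy⟩
    (fun _ _ _ hp hq h h' => ⟨hp.1.trans h, h'.trans hq.2⟩) (fun p hp => Or.inl hp.1), ⟨?_⟩⟩
  exact
  { vec p := if hp : p ∈ Set.Icc x y then tr F hp.1 v else 0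
    dual p := if hp : p ∈ Set.Icc x y then w ∘ₗ tr F hp.2 else 0
    vec_eq_zero h := dif_neg h
    dual_eq_zero h := dif_neg h
    tr_vec {p q} h hp := by
      have hp' : p ∈ Set.Icc x y := hp
      rw [dif_pos hp', tr_tr]
      split_ifs with hq
      · rfl
      · exact htr _ fun hqy => hq ⟨hp'.1.trans h, hqy⟩
    dual_tr {p q} h hq z := by
      have hq' : q ∈ Set.Icc x y := hq
      rw [dif_pos hq']
      split_ifs with hp
      · simp [tr_tr]
      · have := hsub (h.trans hq'.2) fun hxp => hp ⟨hxp, h.trans hq'.2⟩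
        simp [Subsingleton.elim z 0]
    dual_vec {p} hp := by
      have hp' : p ∈ Set.Icc x y := hp
      rw [dif_pos hp', dif_pos hp', LinearMap.comp_apply, tr_tr, hw] }

/-- Every pointwise finite-dimensional module over a bounded poset made of two chains is a direct
sum of interval modules. -/
theorem exists_intervalBasis [Finite P] (A : TwoArms P) (F : P ⥤ ModuleCat.{u} k)
    (hF : ∀ p, Module.Finite k (F.obj p)) :
    ∃ (J : Type) (I : J → PosetInterval P), Nonempty (IntervalBasis F I) := by
  refine exists_intervalBasis_of_splitting (fun G _ hG => ?_) F hF
  by_cases h0 : tr G (A.bot_le A.top) = 0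
  · by_cases hb : Nontrivial (G.obj A.bot)
    · exact A.exists_splitting_bot G h0 hb
    by_cases ht : Nontrivial (G.obj A.top)
    · exact A.exists_splitting_top G h0 ht
    rw [not_nontrivial_iff_subsingleton] at hb ht
    exact A.exists_splitting_interior G hb ht hG
  · exact A.exists_splitting_whole G h0

end TwoArms

/-- The bipath poset has two arms. -/
def Bipath.twoArms {n m : ℕ} (hn : 1 < n) (hm : 1 < m) : TwoArms (Bipath n m) where
  bot := ⟨0, by omega⟩
  top := ⟨n, by omega⟩
  bot_le p := Or.inr (Or.inr ⟨rfl, by omega⟩)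
  le_top p := by
    change (p.val ≤ n ∧ n ≤ n) ∨ (n ≤ n ∧ n ≤ p.val) ∨ _
    omega
  -- Both bounds get the label `true`; their comparabilities with the other arm fall under the first
  -- two alternatives of `cross`.
  arm p := decide (p.val ≤ n)
  total {p q} h := by
    rw [decide_eq_decide] at h
    change ((p.val ≤ q.val ∧ q.val ≤ n) ∨ (n ≤ q.val ∧ q.val ≤ p.val) ∨ _) ∨
      ((q.val ≤ p.val ∧ p.val ≤ n) ∨ (n ≤ p.val ∧ p.val ≤ q.val) ∨ _)
    omega
  cross {p q} h := by
    change (p.val ≤ q.val ∧ q.val ≤ n) ∨ (n ≤ q.val ∧ q.val ≤ p.val) ∨ (p.val = 0 ∧ 0 < n) at h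
    rw [decide_eq_decide, Bipath.ext_iff, Bipath.ext_iff]
    change p.val = 0 ∨ q.val = n ∨ _
    omega

instance (n m : ℕ) : Finite (Bipath n m) :=
  Finite.of_injective (fun p => (⟨p.val, p.lt⟩ : Fin (n + m))) fun _ _ h =>
    Bipath.ext (Fin.mk.inj h)

theorem exists_hasBarcode_bipath {n m : ℕ} (hn : 1 < n) (hm : 1 < m)
    (M : PersistenceModule k (Bipath n m)) : ∃ μ, HasBarcode M μ := by
  obtain ⟨J, I, ⟨b⟩⟩ := (Bipath.twoArms hn hm).exists_intervalBasis
    (M ⋙ forget₂ (FGModuleCat.{u} k) (ModuleCat.{u} k)) inferInstance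
  exact ⟨_, b.hasBarcode⟩

end Splittings

/-! ### Pullback of interval decompositions -/

section Pullback

variable {P Q : Type} [PartialOrder P] [PartialOrder Q]

/-- `C` is a connected component of the preimage of `I`. -/
structure IsComponent (ζ : Q →o P) (I : PosetInterval P) (C : PosetInterval Q) : Prop where
  map_mem {x : Q} : x ∈ C.carrier → ζ x ∈ I.carrier
  mem {x y : Q} : x ∈ C.carrier → (x ≤ y ∨ y ≤ x) → ζ y ∈ I.carrier → y ∈ C.carrier

/-- The component is the class of `x` under zigzag paths in the preimage. It is convex because a
point between two of its elements lies in the preimage, by convexity of `I`, and is comparable to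
them. -/
theorem exists_isComponent (ζ : Q →o P) (I : PosetInterval P) {x : Q} (hx : ζ x ∈ I.carrier) :
    ∃ C, IsComponent ζ I C ∧ x ∈ C.carrier := by
  let R : Q → Q → Prop := fun a b => ζ a ∈ I.carrier ∧ ζ b ∈ I.carrier ∧ (a ≤ b ∨ b ≤ a)
  have hmem : ∀ {y}, Relation.ReflTransGen R x y → ζ y ∈ I.carrier := by
    intro y h
    cases h with
    | refl => exact hx
    | tail _ h => exact h.2.1
  have hpath : ∀ {y}, Relation.ReflTransGen R x y → Relation.ReflTransGen
      (fun a b => Relation.ReflTransGen R x a ∧ Relation.ReflTransGen R x b ∧ (a ≤ b ∨ b ≤ a))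
      x y := by
    intro y h
    induction h with
    | refl => exact .refl
    | tail h h' ih => exact ih.tail ⟨h, h.tail h', h'.2.2⟩
  refine ⟨⟨{y | Relation.ReflTransGen R x y}, ⟨x, .refl⟩, ?_, ?_⟩, ⟨fun h => hmem h, ?_⟩, .refl⟩
  · intro p z q hp hq hpz hzq
    have hz := I.convex (hmem hp) (hmem hq) (ζ.monotone hpz) (ζ.monotone hzq)
    exact hp.tail ⟨hmem hp, hz, Or.inl hpz⟩
  · intro p q hp hq
    have : Std.Symm fun a b => Relation.ReflTransGen R x a ∧ Relation.ReflTransGen R x b ∧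
        (a ≤ b ∨ b ≤ a) := ⟨fun a b h => ⟨h.2.1, h.1, h.2.2.symm⟩⟩
    exact (Relation.ReflTransGen.stdSymm.symm _ _ (hpath hp)).trans (hpath hq)
  · intro y z hy h hz
    exact Relation.ReflTransGen.tail hy ⟨hmem hy, hz, h⟩

theorem IsComponent.eq_of_mem {ζ : Q →o P} {I : PosetInterval P} {C C' : PosetInterval Q}
    (h : IsComponent ζ I C) (h' : IsComponent ζ I C') {x : Q} (hx : x ∈ C.carrier)
    (hx' : x ∈ C'.carrier) : C = C' := by
  refine PosetInterval.ext (Set.Subset.antisymm (fun y hy => ?_) fun y hy => ?_)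
  · exact C.induction_on (S := fun y => y ∈ C'.carrier) hx hx'
      (fun a b _ hb ha' hab => h'.mem ha' hab (h.map_mem hb)) hy
  · exact C'.induction_on (S := fun y => y ∈ C.carrier) hx' hx
      (fun a b _ hb ha' hab => h.mem ha' hab (h'.map_mem hb)) hy

variable {k : Type u} [Field k] {G : P ⥤ ModuleCat.{u} k} {J : Type} {I : J → PosetInterval P}

/-- The components containing `x`, over the intervals containing `ζ x`. -/
def componentEquiv (ζ : Q →o P) (I : J → PosetInterval P) (x : Q) :
    {c : (Σ j, {C // IsComponent ζ (I j) C}) // x ∈ c.2.1.carrier} ≃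
      {j // ζ x ∈ (I j).carrier} :=
  Equiv.ofBijective (fun c => ⟨c.1.1, c.1.2.2.map_mem c.2⟩) (by
    constructor
    · rintro ⟨⟨j, C, hC⟩, hx⟩ ⟨⟨j', C', hC'⟩, hx'⟩ h
      obtain rfl : j = j' := Subtype.mk.inj h
      obtain rfl := hC.eq_of_mem hC' hx hx'
      rfl
    · rintro ⟨j, hj⟩
      obtain ⟨C, hC, hx⟩ := exists_isComponent ζ (I j) hj
      exact ⟨⟨⟨j, C, hC⟩, hx⟩, rfl⟩)

/-- The pullback of a sum of interval modules decomposes into the components of the preimages of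
the intervals. -/
def IntervalBasis.pullback (ζ : Q →o P) (b : IntervalBasis G I) :
    IntervalBasis (ζ.monotone.functor ⋙ G)
      fun c : (Σ j, {C // IsComponent ζ (I j) C}) => c.2.1 where
  basis x := (b.basis (ζ x)).reindex (componentEquiv ζ I x).symm
  tr_basis {x y} h := by
    have key : ∀ x (c : {c : (Σ j, {C // IsComponent ζ (I j) C}) // x ∈ c.2.1.carrier}),
        (b.basis (ζ x)).reindex (componentEquiv ζ I x).symm c =
          b.basis (ζ x) ⟨c.1.1, c.1.2.2.map_mem c.2⟩ :=
      fun x c => Module.Basis.reindex_apply _ _ _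
    intro c
    refine (congrArg (tr G (ζ.monotone h)) (key x c)).trans ((b.tr_basis _ _).trans ?_)
    by_cases hy : y ∈ c.1.2.1.carrier
    · rw [dif_pos hy, dif_pos (c.1.2.2.map_mem hy)]
      exact (key y ⟨c.1, hy⟩).symm
    -- No comparability joins two components, so leaving the component means leaving `I`.
    · rw [dif_neg hy, dif_neg fun hy' => hy (c.1.2.2.mem c.2 (Or.inl h) hy')]
      rfl

end Pullback

/-! ### The covering map -/

section Covering

variable {n m : ℕ}

theorem Bipath.le_iff (p q : Bipath n m) : p ≤ q ↔
    (p.val ≤ q.val ∧ q.val ≤ n) ∨ (n ≤ q.val ∧ q.val ≤ p.val) ∨ (p.val = 0 ∧ 0 < n) := Iff.rfl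

theorem ZZ.mk_le_mk {a b c d : ℤ} {h : a = b ∨ a = b + 1} {h' : c = d ∨ c = d + 1} (hca : c ≤ a)
    (hbd : b ≤ d) : ZZ.mk a b h ≤ ZZ.mk c d h' :=
  ⟨hca, hbd⟩

theorem ZZ.exists_eq_mk (x : ZZ) : (∃ b, x = ZZ.mk b b (Or.inl rfl)) ∨
    ∃ b, x = ZZ.mk (b + 1) b (Or.inr rfl) := by
  rcases x.fst_or with h | h
  · exact Or.inl ⟨x.snd, Subtype.ext (Prod.ext h rfl)⟩
  · exact Or.inr ⟨x.snd, Subtype.ext (Prod.ext h rfl)⟩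

theorem covering_max (hn : 1 < n) (hm : 1 < m) (b : ℤ) :
    (covering hn hm (ZZ.mk b b (Or.inl rfl))).val =
      if b % period n m = 0 then n + m - 1 else (b % period n m).toNat :=
  if_pos rfl

theorem covering_min (hn : 1 < n) (hm : 1 < m) {a b : ℤ} (h : a = b + 1) :
    (covering hn hm (ZZ.mk a b (Or.inr h))).val =
      if b % period n m < n then (b % period n m).toNat else (b % period n m).toNat + 1 :=
  if_neg (show a ≠ b by omega)

theorem add_one_emod_period (hn : 1 < n) (b : ℤ) : (b + 1) % period n m =
    if b % period n m + 1 = period n m then 0 else b % period n m + 1 := by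
  have h := emod_period_bounds (m := m) hn b
  rw [← Int.emod_add_emod]
  split_ifs with h1
  · rw [h1, Int.emod_self]
  · exact Int.emod_eq_of_lt (by omega) (by omega)

/-- One step of path lifting. An element of `ZZ` has only immediate neighbours, so it may first be
necessary to pass from a maximal `x` to the minimal element `y` of its fibre next to it; from there
`y'` is the neighbour lying over the next element towards `q`. -/
theorem covering_lift_up (hn : 1 < n) (hm : 1 < m) (x : ZZ) (q : Bipath n m)
    (h : covering hn hm x < q) : ∃ y y', (x ≤ y ∨ y ≤ x) ∧ y ≤ y' ∧
      covering hn hm y = covering hn hm x ∧ covering hn hm x < covering hn hm y' ∧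
      covering hn hm y' ≤ q := by
  have hN : period n m = (n : ℤ) + m - 1 := rfl
  have hq := q.lt
  rcases x.exists_eq_mk with ⟨b, rfl⟩ | ⟨b, rfl⟩
  · have e₀ := covering_max hn hm b
    have hb := emod_period_bounds (m := m) hn b
    by_cases hv : (covering hn hm (ZZ.mk b b (Or.inl rfl))).val ≤ n
    · refine ⟨ZZ.mk (b + 1) b (Or.inr rfl), ZZ.mk (b + 1) (b + 1) (Or.inl rfl),
        Or.inr (ZZ.mk_le_mk (by omega) (by omega)), ZZ.mk_le_mk (by omega) (by omega), ?_⟩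
      have e₁ := covering_min hn hm (b := b) rfl
      have e₂ := covering_max hn hm (b + 1)
      have hs := add_one_emod_period (m := m) hn b
      simp only [lt_iff_le_and_ne, ne_eq, Bipath.le_iff, Bipath.ext_iff] at h ⊢
      split_ifs at e₀ e₁ e₂ hs <;> omega
    · refine ⟨ZZ.mk b (b - 1) (Or.inr (by ring)), ZZ.mk (b - 1) (b - 1) (Or.inl rfl),
        Or.inr (ZZ.mk_le_mk (by omega) (by omega)), ZZ.mk_le_mk (by omega) (by omega), ?_⟩
      have e₁ := covering_min hn hm (a := b) (b := b - 1) (by ring)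
      have e₂ := covering_max hn hm (b - 1)
      have hb' := emod_period_bounds (m := m) hn (b - 1)
      have hs := add_one_emod_period (m := m) hn (b - 1)
      rw [sub_add_cancel] at hs
      simp only [lt_iff_le_and_ne, ne_eq, Bipath.le_iff, Bipath.ext_iff] at h ⊢
      split_ifs at e₀ e₁ e₂ hs <;> omega
  · have e₀ := covering_min hn hm (b := b) rfl
    have e₁ := covering_max hn hm b
    have e₂ := covering_max hn hm (b + 1)
    have hb := emod_period_bounds (m := m) hn b
    have hs := add_one_emod_period (m := m) hn b
    -- Over 0 both arms start, and the arm of `q` decides the neighbour.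
    by_cases hv : (covering hn hm (ZZ.mk (b + 1) b (Or.inr rfl))).val < n ∧
        ((covering hn hm (ZZ.mk (b + 1) b (Or.inr rfl))).val = 0 → q.val ≤ n)
    · refine ⟨_, ZZ.mk (b + 1) (b + 1) (Or.inl rfl), Or.inl le_rfl,
        ZZ.mk_le_mk (by omega) (by omega), rfl, ?_⟩
      simp only [lt_iff_le_and_ne, ne_eq, Bipath.le_iff, Bipath.ext_iff] at h ⊢
      split_ifs at e₀ e₁ e₂ hs <;> omega
    · refine ⟨_, ZZ.mk b b (Or.inl rfl), Or.inl le_rfl,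
        ZZ.mk_le_mk (by omega) (by omega), rfl, ?_⟩
      simp only [lt_iff_le_and_ne, ne_eq, Bipath.le_iff, Bipath.ext_iff] at h ⊢
      split_ifs at e₀ e₁ e₂ hs <;> omega

theorem covering_lift_down (hn : 1 < n) (hm : 1 < m) (x : ZZ) (q : Bipath n m)
    (h : q < covering hn hm x) : ∃ y y', (x ≤ y ∨ y ≤ x) ∧ y' ≤ y ∧
      covering hn hm y = covering hn hm x ∧ covering hn hm y' < covering hn hm x ∧
      q ≤ covering hn hm y' := by
  have hN : period n m = (n : ℤ) + m - 1 := rfl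
  have hq := q.lt
  rcases x.exists_eq_mk with ⟨b, rfl⟩ | ⟨b, rfl⟩
  · have e₀ := covering_max hn hm b
    have e₁ := covering_min hn hm (b := b) rfl
    have e₂ := covering_min hn hm (a := b) (b := b - 1) (by ring)
    have hb := emod_period_bounds (m := m) hn b
    have hb' := emod_period_bounds (m := m) hn (b - 1)
    have hs := add_one_emod_period (m := m) hn (b - 1)
    rw [sub_add_cancel] at hs
    -- Over `n` both arms end, and the arm of `q` decides the neighbour.
    by_cases hv : (covering hn hm (ZZ.mk b b (Or.inl rfl))).val < n ∨
        ((covering hn hm (ZZ.mk b b (Or.inl rfl))).val = n ∧ q.val ≤ n)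
    · refine ⟨_, ZZ.mk b (b - 1) (Or.inr (by ring)), Or.inl le_rfl,
        ZZ.mk_le_mk (by omega) (by omega), rfl, ?_⟩
      simp only [lt_iff_le_and_ne, ne_eq, Bipath.le_iff, Bipath.ext_iff] at h ⊢
      split_ifs at e₀ e₁ e₂ hs <;> omega
    · refine ⟨_, ZZ.mk (b + 1) b (Or.inr rfl), Or.inl le_rfl,
        ZZ.mk_le_mk (by omega) (by omega), rfl, ?_⟩
      simp only [lt_iff_le_and_ne, ne_eq, Bipath.le_iff, Bipath.ext_iff] at h ⊢
      split_ifs at e₀ e₁ e₂ hs <;> omega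
  · have e₀ := covering_min hn hm (b := b) rfl
    have hb := emod_period_bounds (m := m) hn b
    by_cases hv : (covering hn hm (ZZ.mk (b + 1) b (Or.inr rfl))).val < n
    · refine ⟨ZZ.mk b b (Or.inl rfl), ZZ.mk b (b - 1) (Or.inr (by ring)),
        Or.inl (ZZ.mk_le_mk (by omega) (by omega)), ZZ.mk_le_mk (by omega) (by omega), ?_⟩
      have e₁ := covering_max hn hm b
      have e₂ := covering_min hn hm (a := b) (b := b - 1) (by ring)
      have hb' := emod_period_bounds (m := m) hn (b - 1)
      have hs := add_one_emod_period (m := m) hn (b - 1)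
      rw [sub_add_cancel] at hs
      simp only [lt_iff_le_and_ne, ne_eq, Bipath.le_iff, Bipath.ext_iff] at h ⊢
      split_ifs at e₀ e₁ e₂ hs <;> omega
    · refine ⟨ZZ.mk (b + 1) (b + 1) (Or.inl rfl), ZZ.mk (b + 1 + 1) (b + 1) (Or.inr rfl),
        Or.inl (ZZ.mk_le_mk (by omega) (by omega)), ZZ.mk_le_mk (by omega) (by omega), ?_⟩
      have e₁ := covering_max hn hm (b + 1)
      have e₂ := covering_min hn hm (b := b + 1) rfl
      have hs := add_one_emod_period (m := m) hn b
      simp only [lt_iff_le_and_ne, ne_eq, Bipath.le_iff, Bipath.ext_iff] at h ⊢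
      split_ifs at e₀ e₁ e₂ hs <;> omega

theorem covering_surjective (hn : 1 < n) (hm : 1 < m) (p : Bipath n m) :
    ∃ x, covering hn hm x = p := by
  have hN : period n m = (n : ℤ) + m - 1 := rfl
  have hp := p.lt
  by_cases h : p.val < n
  · refine ⟨ZZ.mk (p.val + 1) p.val (Or.inr rfl), Bipath.ext ?_⟩
    have e : (p.val : ℤ) % period n m = p.val := Int.emod_eq_of_lt (by omega) (by omega)
    rw [covering_min hn hm rfl, e]
    split_ifs <;> omega
  · refine ⟨ZZ.mk p.val p.val (Or.inl rfl), Bipath.ext ?_⟩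
    rw [covering_max]
    by_cases h' : (p.val : ℤ) = period n m
    · rw [h', Int.emod_self, if_pos rfl]
      omega
    · have e : (p.val : ℤ) % period n m = p.val := Int.emod_eq_of_lt (by omega) (by omega)
      rw [e]
      split_ifs <;> omega

theorem covering_translate (hn : 1 < n) (hm : 1 < m) (z : ℤ) (x : ZZ) :
    covering hn hm (ZZ.translate (z * period n m) x) = covering hn hm x := by
  have e : (x.snd + z * period n m) % period n m = x.snd % period n m :=
    Int.add_mul_emod_self_right _ _ _
  have e' : x.fst + z * period n m = x.snd + z * period n m ↔ x.fst = x.snd := by omega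
  apply Bipath.ext
  change (if x.fst + z * period n m = x.snd + z * period n m then
      (if (x.snd + z * period n m) % period n m = 0 then n + m - 1
        else ((x.snd + z * period n m) % period n m).toNat)
    else
      (if (x.snd + z * period n m) % period n m < n
        then ((x.snd + z * period n m) % period n m).toNat
        else ((x.snd + z * period n m) % period n m).toNat + 1)) = _
  simp only [e, e']
  rfl

/-- Elements with the same image are comparable up to translation by a multiple of the period. -/
theorem exists_comparable_translate (hn : 1 < n) (hm : 1 < m) {x y : ZZ}
    (h : covering hn hm x = covering hn hm y) : ∃ z : ℤ,
      x ≤ ZZ.translate (z * period n m) y ∨ ZZ.translate (z * period n m) y ≤ x := by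
  have hN : period n m = (n : ℤ) + m - 1 := rfl
  have hdvd : ∀ a b : ℤ, a % period n m = b % period n m → ∃ z, a = b + z * period n m := by
    intro a b hab
    obtain ⟨c, hc⟩ := Int.ModEq.dvd (show b ≡ a [ZMOD period n m] from hab.symm)
    exact ⟨c, by rw [mul_comm c, ← hc]; ring⟩
  rw [Bipath.ext_iff] at h
  rcases x.exists_eq_mk with ⟨a, rfl⟩ | ⟨a, rfl⟩ <;>
    rcases y.exists_eq_mk with ⟨b, rfl⟩ | ⟨b, rfl⟩
  · rw [covering_max, covering_max] at h
    have ha := emod_period_bounds (m := m) hn a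
    have hb := emod_period_bounds (m := m) hn b
    obtain ⟨z, hz⟩ := hdvd a b (by split_ifs at h <;> omega)
    exact ⟨z, Or.inl ⟨hz.ge, hz.le⟩⟩
  · rw [covering_max, covering_min hn hm rfl] at h
    have ha := emod_period_bounds (m := m) hn a
    have hb := emod_period_bounds (m := m) hn b
    have hs := add_one_emod_period (m := m) hn b
    -- The minimal element `(b + 1, b)` shares its fibre with `(b, b)` on the first arm and with `(b
    -- + 1, b + 1)` on the second.
    by_cases hlt : b % period n m < n
    · obtain ⟨z, hz⟩ := hdvd a b (by split_ifs at h <;> omega)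
      exact ⟨z, Or.inr ⟨show a ≤ b + 1 + z * period n m by omega, hz.ge⟩⟩
    · obtain ⟨z, hz⟩ := hdvd a (b + 1) (by split_ifs at h hs <;> omega)
      exact ⟨z, Or.inr ⟨show a ≤ b + 1 + z * period n m by omega,
        show b + z * period n m ≤ a by omega⟩⟩
  · rw [covering_max, covering_min hn hm rfl] at h
    have ha := emod_period_bounds (m := m) hn a
    have hb := emod_period_bounds (m := m) hn b
    have hs := add_one_emod_period (m := m) hn a
    by_cases hlt : a % period n m < n
    · obtain ⟨z, hz⟩ := hdvd a b (by split_ifs at h <;> omega)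
      exact ⟨z, Or.inl ⟨show b + z * period n m ≤ a + 1 by omega, hz.le⟩⟩
    · obtain ⟨z, hz⟩ := hdvd (a + 1) b (by split_ifs at h hs <;> omega)
      exact ⟨z, Or.inl ⟨hz.ge, show a ≤ b + z * period n m by omega⟩⟩
  · rw [covering_min hn hm rfl, covering_min hn hm rfl] at h
    have ha := emod_period_bounds (m := m) hn a
    have hb := emod_period_bounds (m := m) hn b
    obtain ⟨z, hz⟩ := hdvd a b (by split_ifs at h <;> omega)
    exact ⟨z, Or.inl ⟨show b + 1 + z * period n m ≤ a + 1 by omega, hz.le⟩⟩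

/-! ### Components of preimages under the covering map -/

/-- Since `I` is connected, it is enough to follow a comparability inside `I` upwards or downwards.
Each lifted step moves strictly in the finite poset `B`, so the process ends, and by convexity its
image stays in `I`, so the lift stays in `C`. -/
theorem IsComponent.image_eq {hn : 1 < n} {hm : 1 < m} {I : PosetInterval (Bipath n m)}
    {C : PosetInterval ZZ} (h : IsComponent (covering hn hm) I C) :
    covering hn hm '' C.carrier = I.carrier := by
  refine Set.Subset.antisymm (by rintro _ ⟨x, hx, rfl⟩; exact h.map_mem hx) fun p hp => ?_
  have up : ∀ p, p ∈ I.carrier → ∀ a, a ∈ covering hn hm '' C.carrier → a ≤ p →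
      p ∈ covering hn hm '' C.carrier := by
    intro p hp a
    induction a using WellFoundedGT.induction with
    | _ a ih =>
      rintro ⟨x, hx, rfl⟩ hap
      rcases hap.eq_or_lt with rfl | hlt
      · exact ⟨x, hx, rfl⟩
      · obtain ⟨y, y', hy, hyy', e, hlt', hle⟩ := covering_lift_up hn hm x p hlt
        have hyC := h.mem hx hy (by rw [e]; exact h.map_mem hx)
        have hyC' := h.mem hyC (Or.inl hyy') (I.convex (h.map_mem hx) hp hlt'.le hle)
        exact ih _ hlt' ⟨y', hyC', rfl⟩ hle
  have down : ∀ p, p ∈ I.carrier → ∀ a, a ∈ covering hn hm '' C.carrier → p ≤ a →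
      p ∈ covering hn hm '' C.carrier := by
    intro p hp a
    induction a using WellFoundedLT.induction with
    | _ a ih =>
      rintro ⟨x, hx, rfl⟩ hap
      rcases hap.eq_or_lt with rfl | hlt
      · exact ⟨x, hx, rfl⟩
      · obtain ⟨y, y', hy, hyy', e, hlt', hle⟩ := covering_lift_down hn hm x p hlt
        have hyC := h.mem hx hy (by rw [e]; exact h.map_mem hx)
        have hyC' := h.mem hyC (Or.inr hyy') (I.convex hp (h.map_mem hx) hle hlt'.le)
        exact ih _ hlt' ⟨y', hyC', rfl⟩ hle
  obtain ⟨x, hx⟩ := C.nonempty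
  refine I.induction_on (S := fun p => p ∈ covering hn hm '' C.carrier) (h.map_mem hx)
    ⟨x, hx, rfl⟩ (fun a b _ hb haS hab => ?_) hp
  exact hab.elim (up b hb a haS) (down b hb a haS)

theorem IsComponent.unique {hn : 1 < n} {hm : 1 < m} {I I' : PosetInterval (Bipath n m)}
    {C : PosetInterval ZZ} (h : IsComponent (covering hn hm) I C)
    (h' : IsComponent (covering hn hm) I' C) : I = I' :=
  PosetInterval.ext (h.image_eq.symm.trans h'.image_eq)

theorem exists_component (hn : 1 < n) (hm : 1 < m) (I : PosetInterval (Bipath n m)) :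
    ∃ C, IsComponent (covering hn hm) I C := by
  obtain ⟨p, hp⟩ := I.nonempty
  obtain ⟨x, rfl⟩ := covering_surjective hn hm p
  obtain ⟨C, hC, -⟩ := exists_isComponent (covering hn hm) I hp
  exact ⟨C, hC⟩

theorem translate_mem_shift {t : ℤ} {C : PosetInterval ZZ} {x : ZZ} :
    ZZ.translate t x ∈ (shift t C).carrier ↔ x ∈ C.carrier := by
  change ZZ.translate (-t) (ZZ.translate t x) ∈ C.carrier ↔ _
  rw [ZZ.translate_neg_translate]

theorem IsComponent.shift {hn : 1 < n} {hm : 1 < m} {I : PosetInterval (Bipath n m)}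
    {C : PosetInterval ZZ} (h : IsComponent (covering hn hm) I C) (z : ℤ) :
    IsComponent (covering hn hm) I (shift (z * period n m) C) := by
  have e : ∀ x, covering hn hm (ZZ.translate (-(z * period n m)) x) = covering hn hm x := by
    intro x
    rw [← neg_mul, covering_translate]
  constructor
  · intro x hx
    rw [← e]
    exact h.map_mem hx
  · intro x y hx hxy hy
    exact h.mem hx (hxy.imp (ZZ.translate_mono _) (ZZ.translate_mono _)) (by rwa [e])

/-- Both components map onto `I`, so they contain points of one fibre, and these are comparable
after a translation. The translated component then meets `C`, hence equals it. -/
theorem IsComponent.exists_shift_eq {hn : 1 < n} {hm : 1 < m} {I : PosetInterval (Bipath n m)}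
    {C C' : PosetInterval ZZ} (h : IsComponent (covering hn hm) I C)
    (h' : IsComponent (covering hn hm) I C') :
    ∃ z : ℤ, BipathPersistence.shift (z * period n m) C' = C := by
  obtain ⟨x, hx⟩ := C.nonempty
  obtain ⟨y, hy, e⟩ : covering hn hm x ∈ covering hn hm '' C'.carrier := by
    rw [h'.image_eq]
    exact h.map_mem hx
  obtain ⟨z, hz⟩ := exists_comparable_translate hn hm e.symm
  refine ⟨z, (h'.shift z).eq_of_mem h (translate_mem_shift.2 hy) (h.mem hx hz ?_)⟩
  rw [covering_translate]
  exact h'.map_mem hy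

end Covering

/-! ### The barcode of the restriction -/

section Restriction

variable {k : Type u} [Field k] {n m : ℕ} (hn : 1 < n) (hm : 1 < m)

theorem HasBarcode.exists_restriction {M : PersistenceModule k (Bipath n m)}
    {μ : PosetInterval (Bipath n m) → ℕ} (h : HasBarcode M μ) :
    ∃ ν, HasBarcode ((restriction k hn hm).obj M) ν ∧
      (∀ I C, IsComponent (covering hn hm) I C → ν C = μ I) ∧
      ∀ C, ν C ≠ 0 → ∃ I, IsComponent (covering hn hm) I C := by
  obtain ⟨b⟩ := hasBarcode_iff.1 h
  refine ⟨_, (b.pullback (covering hn hm)).hasBarcode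
    (M := (restriction k hn hm).obj M), fun I C hC => ?_, fun C hC => ?_⟩
  -- Summands of the restriction on `C` correspond to summands of `M` on `I`: `C` is a component
  -- over no other interval, and every summand on `I` contributes it once.
  · rw [← card_sigma_fst μ I]
    refine Nat.card_congr (Equiv.ofBijective
      (fun c => ⟨c.1.1, by
        have h := c.1.2.2
        rw [c.2] at h
        exact h.unique hC⟩) ⟨?_, ?_⟩)
    · rintro ⟨⟨j, C, h⟩, rfl⟩ ⟨⟨j', C', h'⟩, hCC'⟩ e
      obtain rfl : j = j' := Subtype.mk.inj e
      obtain rfl : C' = C := hCC'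
      rfl
    · rintro ⟨j, rfl⟩
      exact ⟨⟨⟨j, C, hC⟩, rfl⟩, rfl⟩
  · obtain ⟨⟨c, rfl⟩⟩ := (Nat.card_ne_zero.1 hC).1
    exact ⟨_, c.2.2⟩

theorem hasBarcode_barcode (hn : 1 < n) (hm : 1 < m) (M : PersistenceModule k (Bipath n m)) :
    HasBarcode M (barcode M) := by
  obtain ⟨μ, h⟩ := exists_hasBarcode_bipath hn hm M
  rwa [h.barcode_eq]

theorem hasBarcode_barcode_restriction (M : PersistenceModule k (Bipath n m)) :
    HasBarcode ((restriction k hn hm).obj M) (barcode ((restriction k hn hm).obj M)) := by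
  obtain ⟨ν, h, -⟩ := (hasBarcode_barcode hn hm M).exists_restriction hn hm
  rwa [h.barcode_eq]

theorem barcode_restriction_eq (M : PersistenceModule k (Bipath n m))
    {I : PosetInterval (Bipath n m)} {C : PosetInterval ZZ}
    (hC : IsComponent (covering hn hm) I C) :
    barcode ((restriction k hn hm).obj M) C = barcode M I := by
  obtain ⟨ν, h, h', -⟩ := (hasBarcode_barcode hn hm M).exists_restriction hn hm
  rw [h.barcode_eq, h' I C hC]

theorem exists_isComponent_of_barcode_ne_zero (M : PersistenceModule k (Bipath n m))
    {C : PosetInterval ZZ} (hC : barcode ((restriction k hn hm).obj M) C ≠ 0) :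
    ∃ I, IsComponent (covering hn hm) I C := by
  obtain ⟨ν, h, -, h'⟩ := (hasBarcode_barcode hn hm M).exists_restriction hn hm
  rw [h.barcode_eq] at hC
  exact h' C hC

theorem barcode_restriction_eq_iff (M M' : PersistenceModule k (Bipath n m)) :
    barcode ((restriction k hn hm).obj M) = barcode ((restriction k hn hm).obj M') ↔
      Nonempty (M ≅ M') := by
  constructor
  · intro h
    refine (hasBarcode_barcode hn hm M).nonempty_iso ?_
    have e : barcode M = barcode M' := by
      funext I
      obtain ⟨C, hC⟩ := exists_component hn hm I
      rw [← barcode_restriction_eq hn hm M hC, h, barcode_restriction_eq hn hm M' hC]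
    rw [e]
    exact hasBarcode_barcode hn hm M'
  · rintro ⟨e⟩
    exact ((hasBarcode_barcode_restriction hn hm M').of_iso
      ((restriction k hn hm).mapIso e.symm)).barcode_eq

/-! ### The translation action of `ℤ` -/

theorem shift_zero (J : PosetInterval ZZ) : shift 0 J = J := by
  ext p
  have e : ZZ.translate (-0) p = p :=
    Subtype.ext (Prod.ext (show p.fst + -0 = p.fst by ring) (show p.snd + -0 = p.snd by ring))
  change ZZ.translate (-0) p ∈ J.carrier ↔ _
  rw [e]

theorem shift_add (s t : ℤ) (J : PosetInterval ZZ) : shift (s + t) J = shift s (shift t J) := by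
  ext p
  have e : ZZ.translate (-(s + t)) p = ZZ.translate (-t) (ZZ.translate (-s) p) :=
    Subtype.ext (Prod.ext (show p.fst + -(s + t) = p.fst + -s + -t by ring)
      (show p.snd + -(s + t) = p.snd + -s + -t by ring))
  change ZZ.translate (-(s + t)) p ∈ J.carrier ↔
    ZZ.translate (-t) (ZZ.translate (-s) p) ∈ J.carrier
  rw [e]

/-- The action of `ℤ` by translation by multiples of `t` on an invariant multiset of intervals. -/
@[reducible]
def shiftAction (t : ℤ) (μ : PosetInterval ZZ → ℕ)
    (h : ∀ (z : ℤ) J, μ J ≠ 0 → μ (shift (z * t) J) ≠ 0) : AddAction ℤ (supp μ) where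
  vadd z J := ⟨shift (z * t) J.1, h z J.1 J.2⟩
  zero_vadd J := Subtype.ext (by
    change shift (0 * t) J.1 = J.1
    rw [zero_mul, shift_zero])
  add_vadd z w J := Subtype.ext (by
    change shift ((z + w) * t) J.1 = shift (z * t) (shift (w * t) J.1)
    rw [add_mul, shift_add])

theorem barcode_restriction_shift (M : PersistenceModule k (Bipath n m)) (z : ℤ)
    {J : PosetInterval ZZ} (hJ : barcode ((restriction k hn hm).obj M) J ≠ 0) :
    barcode ((restriction k hn hm).obj M) (shift (z * period n m) J) =
      barcode ((restriction k hn hm).obj M) J := by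
  obtain ⟨I, hI⟩ := exists_isComponent_of_barcode_ne_zero hn hm M hJ
  rw [barcode_restriction_eq hn hm M hI, barcode_restriction_eq hn hm M (hI.shift z)]

end Restriction

end

end BipathPersistence

open BipathPersistence
-- The main theorem
theorem mainTheorem1 {k : Type u} [Field k] {n m : ℕ} (hn : 1 < n) (hm : 1 < m)
    (M : PersistenceModule k (Bipath n m)) :
    -- the arc code of `M` and the barcode of `R(M)` exist and are uniquely determined
    (∃! μ, HasBarcode M μ) ∧
    (∃! μ', HasBarcode ((restriction k hn hm).obj M) μ') ∧
    -- the barcode of `R(M)` is a complete invariant of `M`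
    (∀ M' : PersistenceModule k (Bipath n m),
      barcode ((restriction k hn hm).obj M) =
        barcode ((restriction k hn hm).obj M') ↔
      Nonempty (M ≅ M')) ∧
    -- `ℤ` acts on the barcode of `R(M)` by shifting endpoints by multiples of `N`
    ∃ _ : AddAction ℤ (supp
        (barcode ((restriction k hn hm).obj M))),
      (∀ (z : ℤ) (J : supp
          (barcode ((restriction k hn hm).obj M))),
        (z +ᵥ J).1 = shift (z * period n m) J.1 ∧
        barcode ((restriction k hn hm).obj M) (z +ᵥ J).1 =
          barcode ((restriction k hn hm).obj M) J.1) ∧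
      -- and the orbit space is in multiplicity-preserving bijection with the arc code of `M`
      ∃ φ : supp (barcode M) ≃
          AddAction.orbitRel.Quotient ℤ (supp
            (barcode ((restriction k hn hm).obj M))),
        ∀ (I : supp (barcode M))
          (J : supp
            (barcode ((restriction k hn hm).obj M))),
          φ I = Quotient.mk _ J →
          barcode ((restriction k hn hm).obj M) J.1 =
            barcode M I.1 := by
  have hM := hasBarcode_barcode hn hm M
  have hR := hasBarcode_barcode_restriction hn hm M
  refine ⟨⟨_, hM, fun μ h => h.unique hM⟩, ⟨_, hR, fun μ h => h.unique hR⟩,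
    barcode_restriction_eq_iff hn hm M, shiftAction (period n m) _ fun z J hJ => by
      rwa [barcode_restriction_shift hn hm M z hJ],
    fun z J => ⟨rfl, barcode_restriction_shift hn hm M z J.2⟩, ?_⟩
  choose base hbase using fun J : supp (barcode ((restriction k hn hm).obj M)) =>
    exists_isComponent_of_barcode_ne_zero hn hm M J.2
  have hmult := fun J => barcode_restriction_eq hn hm M (hbase J)
  let := shiftAction (period n m) (barcode ((restriction k hn hm).obj M)) fun z J hJ => by
      rwa [barcode_restriction_shift hn hm M z hJ]
  -- The inverse of `φ` sends the orbit of `J` to the interval over which `J` is a component.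
  -- Translates lie over the same interval; injectivity is transitivity on the components over one
  -- interval, and surjectivity is their existence.
  let ψ : AddAction.orbitRel.Quotient ℤ (supp (barcode ((restriction k hn hm).obj M))) →
      supp (barcode M) :=
    Quotient.lift (fun J => ⟨base J, by rw [← hmult]; exact J.2⟩) (by
      rintro J J' ⟨z, rfl⟩
      exact Subtype.ext ((hbase _).unique ((hbase J').shift z)))
  have hψ : Function.Bijective ψ := by
    constructor
    · rintro ⟨J⟩ ⟨J'⟩ h
      have h' : base J = base J' := congrArg Subtype.val h
      obtain ⟨z, hz⟩ := (hbase J).exists_shift_eq (h' ▸ hbase J')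
      exact Quotient.sound ⟨z, Subtype.ext hz⟩
    · rintro ⟨I, hI⟩
      obtain ⟨C, hC⟩ := exists_component hn hm I
      refine ⟨Quotient.mk _ ⟨C, by rwa [barcode_restriction_eq hn hm M hC]⟩, Subtype.ext ?_⟩
      exact (hbase ⟨C, _⟩).unique hC
  refine ⟨(Equiv.ofBijective ψ hψ).symm, fun I J h => ?_⟩
  rw [Equiv.symm_apply_eq] at h
  rw [h]
  exact hmult J
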